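/- Let $H$ be a complex Hilbert space, let $0<\alpha<1$ and $\eta\ge 0$, and let $\mathcal A:\mathcal D(\mathcal A)\subset H\to H$ be m-dissipative, i.e. linear with $\mathrm{Re}\langle \mathcal A x,x\rangle\le 0$ for all $x\in\mathcal D(\mathcal A)$ and $\lambda I-\mathcal A$ onto $H$ for some $\lambda>0$. Put $g_\beta(t)=t^{\beta-1}/\Gamma(\beta)$ for $t>0$, $g_\beta(t)=0$ for $t\le 0$, and $(a*u)(t)=\int_0^t a(t-s)u(s)\,ds$. Consider the problem $$\partial_t^{\alpha,\eta}u(t)=\mathcal A u(t)-\frac{\eta}{\Gamma(1-\alpha)}\int_0^t (t-s)^{-\alpha}e^{-\eta(t-s)}u(s)\,ds\quad(t>0),\qquad u(0)=u^0,\tag{P}$$ where $\partial_t^{\alpha,\eta}u(t)=\frac1{\Gamma(1-\alpha)}\int_0^t(t-s)^{-\alpha}e^{-\eta(t-s)}u'(s)\,ds$. A strong solution of (P) is a function $u\in C(\mathbb R_+,\mathcal D(\mathcal A))$ (graph norm) such that $g_{1-\alpha}*(e^{\eta\cdot}u-u^0)\in C^1(\mathbb R_+,H)$ and (P) holds; here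 $u\in W^{1,1}_{\rm loc}(\mathbb R_+;H)$ and the integral defining $\partial_t^{\alpha,\eta}u(t)$ converges for every $t>0$. A strong solution in the extended sense satisfies the same conditions, except that $u\in W^{1,1}_{\rm loc}$ is not required and $\partial_t^{\alpha,\eta}u(t)$ is read as $\frac{d}{dt}\,\frac1{\Gamma(1-\alpha)}\int_0^t(t-s)^{-\alpha}e^{-\eta(t-s)}(u(s)-u(0))\,ds$. For either notion, (P) is called well-posed if for every $u^0\in\mathcal D(\mathcal A)$ there is exactly one strong solution $u(\cdot,u^0)$ on $\mathbb R_+$, and $u^0_n\in\mathcal D(\mathcal A)$, $u^0_n\to 0$ imply $u(t,u_n^0)\to 0$ in $H$ uniformly on compact intervals. Then (P) is well-posed, for both notions of strong solution. Moreover $\mathcal A$ generates a solution operator, i.e. there is a family $(S_{\alpha,\eta}(t))_{t\ge0}$ in $\mathcal L(H)$ such that: (a) $t\mapsto S_{\alpha,\eta}(t)x$ is continuous on $[0,\infty)$ for every $x\in H$, and $S_{\alpha,\eta}(0)=I$; (b) $S_{\alpha,\eta}(t)\mathcal D(\mathcal A)\subset\mathcal D(\mathcal A)$ and $\mathcal A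 S_{\alpha,\eta}(t)x=S_{\alpha,\eta}(t)\mathcal A x$ for all $x\in\mathcal D(\mathcal A)$, $t\ge0$; (c) $S_{\alpha,\eta}(t)x=e^{-\eta t}x+e^{-\eta t}\big(g_\alpha*(e^{\eta\cdot}\mathcal A S_{\alpha,\eta}(\cdot)x)\big)(t)$ for all $x\in\mathcal D(\mathcal A)$, $t\ge0$; and $t\mapsto S_{\alpha,\eta}(t)u^0$ is the strong solution of (P) for every $u^0\in\mathcal D(\mathcal A)$. If $\eta>0$, the problem is exponentially stable: there is $M>0$ such that $$\|S_{\alpha,\eta}(t)u^0\|_H\le M e^{-\eta t}\|u^0\|_H\qquad\text{for all }u^0\in\mathcal D(\mathcal A),\ t\ge 0.$$ -/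

import Mathlib

open Set Filter Topology MeasureTheory

namespace FracCauchy

noncomputable section

/-- The total function which equals `A x` for `x` in the domain of `A` (and `0` elsewhere). It is only
used next to the requirement that its argument belongs to the domain. -/
def opVal {H : Type*} [NormedAddCommGroup H] [InnerProductSpace ℂ H]
    (A : H →ₗ.[ℂ] H) (x : H) : H :=
  open Classical in if h : x ∈ A.domain then A ⟨x, h⟩ else 0

/-- `A` is dissipative: `Re ⟨A x, x⟩ ≤ 0` on the domain. -/
def IsDissipative {H : Type*} [NormedAddCommGroup H] [InnerProductSpace ℂ H]
    (A : H →ₗ.[ℂ] H) : Prop :=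
  ∀ x : A.domain, (inner ℂ (x : H) (A x)).re ≤ 0

/-- `A` is m-dissipative: it is dissipative and `l I - A` is onto for some `l > 0`. -/
def IsMDissipative {H : Type*} [NormedAddCommGroup H] [InnerProductSpace ℂ H]
    (A : H →ₗ.[ℂ] H) : Prop :=
  IsDissipative A ∧ ∃ l : ℝ, 0 < l ∧ ∀ y : H, ∃ x : A.domain, l • (x : H) - A x = y

/-- The convolution `(a * u)(t) = ∫₀ᵗ a (t - s) u(s) ds`. -/
def conv {H : Type*} [NormedAddCommGroup H] [NormedSpace ℝ H]
    (a : ℝ → ℝ) (u : ℝ → H) (t : ℝ) : H :=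
  ∫ s in (0 : ℝ)..t, a (t - s) • u s

/-- `g_β(t) = t ^ (β - 1) / Γ(β)` for `t > 0`, and `0` for `t ≤ 0`. -/
def gKer (β t : ℝ) : ℝ :=
  if 0 < t then t ^ (β - 1) / Real.Gamma β else 0

/-- The tempered kernel `t ^ (-α) e ^ (-η t) / Γ(1 - α)`. -/
def temperedKer (α η t : ℝ) : ℝ :=
  1 / Real.Gamma (1 - α) * (t ^ (-α) * Real.exp (-η * t))

/-- `u` lies in `W^{1,1}_loc` on `[0, ∞)` and `w` is its derivative: `w` is integrable on bounded
intervals and `u(t) = u(0) + ∫₀ᵗ w(s) ds`. -/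
def HasLocIntegrableDeriv {H : Type*} [NormedAddCommGroup H] [NormedSpace ℝ H]
    (u w : ℝ → H) : Prop :=
  (∀ T : ℝ, 0 < T → IntervalIntegrable w volume 0 T) ∧
    ∀ t : ℝ, 0 ≤ t → u t = u 0 + ∫ s in (0 : ℝ)..t, w s

/-- The regularity required of strong solutions: `u ∈ C(ℝ₊, D(A))` (graph norm) and
`g_{1-α} * (e^{η ·} u - u⁰) ∈ C¹(ℝ₊, H)`. -/
structure StrongRegularity {H : Type*} [NormedAddCommGroup H] [InnerProductSpace ℂ H]
    (A : H →ₗ.[ℂ] H) (α η : ℝ) (u0 : H) (u : ℝ → H) : Prop where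
  continuousOn : ContinuousOn u (Ici 0)
  mem_domain : ∀ t : ℝ, 0 ≤ t → u t ∈ A.domain
  continuousOn_op : ContinuousOn (fun t => opVal A (u t)) (Ici 0)
  contDiffOn : ContDiffOn ℝ 1
    (conv (gKer (1 - α)) (fun s => Real.exp (η * s) • u s - u0)) (Ici 0)

/-- Strong solutions `u` of
`∂ₜ^{α,η} u(t) = A u(t) - η / Γ(1-α) ∫₀ᵗ (t-s)^{-α} e^{-η(t-s)} u(s) ds` for `t > 0`, `u(0) = u⁰`, where
`∂ₜ^{α,η} u(t) = 1 / Γ(1-α) ∫₀ᵗ (t-s)^{-α} e^{-η(t-s)} u'(s) ds`. The derivative `u' = w` is taken in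
`W^{1,1}_loc`, and the integral defining `∂ₜ^{α,η} u(t)` converges for every `t > 0`. -/
def IsStrongSolution {H : Type*} [NormedAddCommGroup H] [InnerProductSpace ℂ H]
    (A : H →ₗ.[ℂ] H) (α η : ℝ) (u0 : H) (u : ℝ → H) : Prop :=
  StrongRegularity A α η u0 u ∧ u 0 = u0 ∧
    ∃ w : ℝ → H, HasLocIntegrableDeriv u w ∧
      ∀ t : ℝ, 0 < t →
        IntervalIntegrable (fun s => temperedKer α η (t - s) • w s) volume 0 t ∧
        conv (temperedKer α η) w t
          = opVal A (u t) - η • conv (temperedKer α η) u t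

/-- Strong solutions in the wider sense that does not ask for a derivative of `u` itself: the
derivative is taken after the convolution, that is
`∂ₜ^{α,η} u(t) = d/dt (1 / Γ(1-α) ∫₀ᵗ (t-s)^{-α} e^{-η(t-s)} (u(s) - u(0)) ds)`. -/
def IsExtendedStrongSolution {H : Type*} [NormedAddCommGroup H] [InnerProductSpace ℂ H]
    (A : H →ₗ.[ℂ] H) (α η : ℝ) (u0 : H) (u : ℝ → H) : Prop :=
  StrongRegularity A α η u0 u ∧ u 0 = u0 ∧
    ∀ t : ℝ, 0 < t →
      HasDerivAt (conv (temperedKer α η) (fun s => u s - u 0))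
        (opVal A (u t) - η • conv (temperedKer α η) u t) t

/-- Well-posedness of a Cauchy problem whose solutions with initial value `u⁰` are given by the
predicate `Sol u⁰`: for each `u⁰ ∈ D(A)` there is exactly one solution on `[0, ∞)`, and solutions whose
initial values in `D(A)` tend to `0` tend to `0` uniformly on compact intervals. -/
structure WellPosed {H : Type*} [NormedAddCommGroup H] [InnerProductSpace ℂ H]
    (A : H →ₗ.[ℂ] H) (Sol : H → (ℝ → H) → Prop) : Prop where
  exists_solution : ∀ u0 ∈ A.domain, ∃ u : ℝ → H, Sol u0 u
  unique_solution : ∀ u0 ∈ A.domain, ∀ u v : ℝ → H, Sol u0 u → Sol u0 v → EqOn u v (Ici 0)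
  continuous_dependence : ∀ (u0 : ℕ → H) (u : ℕ → ℝ → H),
    (∀ n, u0 n ∈ A.domain) → (∀ n, Sol (u0 n) (u n)) → Tendsto u0 atTop (𝓝 0) →
      ∀ T : ℝ, 0 < T → TendstoUniformlyOn u (fun _ => 0) atTop (Icc 0 T)

/-- `(S(t))_{t ≥ 0}` is a solution operator (resolvent). Only the values at `t ≥ 0` matter. -/
structure IsSolutionOperator {H : Type*} [NormedAddCommGroup H] [InnerProductSpace ℂ H]
    (A : H →ₗ.[ℂ] H) (α η : ℝ) (S : ℝ → H →L[ℂ] H) : Prop where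
  strongly_continuous : ∀ x : H, ContinuousOn (fun t => S t x) (Ici 0)
  map_zero : S 0 = ContinuousLinearMap.id ℂ H
  map_domain : ∀ t : ℝ, 0 ≤ t → ∀ x ∈ A.domain, S t x ∈ A.domain
  commutes : ∀ t : ℝ, 0 ≤ t → ∀ x ∈ A.domain, opVal A (S t x) = S t (opVal A x)
  resolvent_eq : ∀ x ∈ A.domain, ∀ t : ℝ, 0 ≤ t →
    S t x = Real.exp (-η * t) • x
      + Real.exp (-η * t) • conv (gKer α) (fun s => Real.exp (η * s) • opVal A (S s x)) t

end

end FracCauchy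

/-! Tempering is a change of unknown. With `v(t) = e^{ηt} u(t)` the factor `e^{-η(t-s)}` splits, and
(P) becomes the Caputo equation of order `α` for `v`, which integrates to `g_{1-α} * (v - u⁰) = 1 *
Av`. So everything reduces to a bounded solution operator `S(t)` (`solOp`) for the untempered
equation; the solution of (P) is `e^{-ηt} S(t) u⁰`, and the factor `e^{-ηt}` gives the stability.

The Laplace transform of `S` has to be `μ^{α-1} (μ^α - A)^{-1}`. An m-dissipative `A` has a
resolvent on the open right half-plane, bounded by `1 / Re z` and holomorphic. Since `α < 1`, there
is a sector of half-angle `θ > π/2` which `w ↦ w^α` maps into that half-plane. Integrating `e^{tw}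
(w^α - A)^{-1} / (2πi)` over its boundary rays defines `P(t)` (`invLaplace`), with `‖P(t)‖ ≤ C
t^{α-1}` by scaling and with transform `(μ^α - A)^{-1}` by Fubini and Cauchy's formula
(`strip_integral_sub`, `laplace_invLaplace`).

Put `S = g_{1-α} * P`. The singularities `(t-s)^{-α}` and `s^{α-1}` have total degree `-1`, so `S`
is bounded uniformly in `t`. Injectivity of the Laplace transform gives `S(t)x = x + ∫₀ᵗ P(s) A x
ds` on the domain (`solOp_apply_eq`). This one identity yields continuity, differentiability,
existence, and, with `g_α * g_{1-α} = 1`, the resolvent equation.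

For uniqueness, convolve `g_{1-α} * (v - x) = 1 * Av` with `P`: the left side is `S * (v - x)`, the
right side `(1 * P) * Av`, and the identity above turns this into `1 * v = 1 * Sx`
(`eq_solOp_of_conv_eq`). Continuous dependence is then read off from the formula for the solution.
Strong solutions are extended ones, so the extended notion carries uniqueness, while existence is
proved for the stricter notion. -/

namespace FracCauchy

/-! ### Resolvents of m-dissipative operators on the right half-plane. -/

section Resolvent

variable {H : Type*} [NormedAddCommGroup H] [InnerProductSpace ℂ H]

/-- `R` is a bounded two-sided inverse of `z - A`. -/
structure IsResolvent (A : H →ₗ.[ℂ] H) (z : ℂ) (R : H →L[ℂ] H) : Prop where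
  mem_domain : ∀ y, R y ∈ A.domain
  right_inv : ∀ y, z • R y - A ⟨R y, mem_domain y⟩ = y
  left_inv : ∀ x : A.domain, R (z • (x : H) - A x) = x

/-- Pair `zx - Ax` with `x`: the `A`-term only increases the real part, and Cauchy–Schwarz bounds
the pairing from above. -/
theorem IsDissipative.norm_le {A : H →ₗ.[ℂ] H} (hA : IsDissipative A) (z : ℂ) (x : A.domain) :
    z.re * ‖(x : H)‖ ≤ ‖z • (x : H) - A x‖ := by
  rcases (norm_nonneg (x : H)).eq_or_lt with h | h
  · rw [← h]; simp
  have h1 : z.re * ‖(x : H)‖ ^ 2 ≤ (inner ℂ (x : H) (z • (x : H) - A x)).re := by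
    rw [inner_sub_right, inner_smul_right, inner_self_eq_norm_sq_to_K]
    have := hA x
    have h2 : (z * ((‖(x : H)‖ : ℂ)) ^ 2).re = z.re * ‖(x : H)‖ ^ 2 := by
      rw [← Complex.ofReal_pow, Complex.re_mul_ofReal]
    simp only [Complex.coe_algebraMap, Complex.sub_re]
    linarith
  have h3 : (inner ℂ (x : H) (z • (x : H) - A x)).re ≤ ‖(x : H)‖ * ‖z • (x : H) - A x‖ :=
    (Complex.re_le_norm _).trans (norm_inner_le_norm _ _)
  have h4 : ‖(x : H)‖ * (z.re * ‖(x : H)‖) ≤ ‖(x : H)‖ * ‖z • (x : H) - A x‖ := by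
    nlinarith
  exact le_of_mul_le_mul_left h4 h

theorem IsResolvent.norm_le {A : H →ₗ.[ℂ] H} (hA : IsDissipative A) {z : ℂ} (hz : 0 < z.re)
    {R : H →L[ℂ] H} (hR : IsResolvent A z R) : ‖R‖ ≤ z.re⁻¹ := by
  refine R.opNorm_le_bound (by positivity) fun y => ?_
  have := hA.norm_le z ⟨R y, hR.mem_domain y⟩
  rw [hR.right_inv] at this
  rw [inv_mul_eq_div, le_div_iff₀ hz]
  linarith

/-- Dissipativity already supplies injectivity and the norm bound, so surjectivity is all that
remains to be checked. -/
theorem IsDissipative.exists_isResolvent {A : H →ₗ.[ℂ] H} (hA : IsDissipative A) {z : ℂ}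
    (hz : 0 < z.re) (hs : ∀ y : H, ∃ x : A.domain, z • (x : H) - A x = y) :
    ∃ R, IsResolvent A z R := by
  let T : A.domain →ₗ[ℂ] H := z • A.domain.subtype - A.toFun
  have hT : ∀ x, T x = z • (x : H) - A x := fun x => rfl
  have hinj : Function.Injective T := by
    rw [← LinearMap.ker_eq_bot, LinearMap.ker_eq_bot']
    intro x hx
    have := hA.norm_le z x
    rw [← hT, hx, norm_zero] at this
    have h : ‖(x : H)‖ ≤ 0 := by
      by_contra! hc
      have := mul_pos hz hc
      linarith
    exact Subtype.ext (by simpa using h)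
  let e := LinearEquiv.ofBijective T ⟨hinj, hs⟩
  have he : ∀ y, z • ((e.symm y : A.domain) : H) - A (e.symm y) = y := fun y =>
    e.apply_symm_apply y
  refine ⟨(A.domain.subtype ∘ₗ e.symm.toLinearMap).mkContinuous z.re⁻¹ fun y => ?_,
    fun y => (e.symm y).2, fun y => he y, fun x => ?_⟩
  · have := hA.norm_le z (e.symm y)
    rw [he] at this
    rw [inv_mul_eq_div, le_div_iff₀ hz, mul_comm]
    exact this
  · exact congrArg Subtype.val (e.symm_apply_apply x)

/-- Neumann series: `w - A = (1 - (z - w) R)(z - A)`, and `‖R‖ ≤ 1 / Re z` makes the perturbation a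
strict contraction. -/
theorem IsResolvent.exists_of_norm_lt [CompleteSpace H] {A : H →ₗ.[ℂ] H} (hA : IsDissipative A)
    {z w : ℂ} (hz : 0 < z.re) (hw : 0 < w.re) (hzw : ‖w - z‖ < z.re) {R : H →L[ℂ] H}
    (hR : IsResolvent A z R) : ∃ R', IsResolvent A w R' := by
  refine hA.exists_isResolvent hw fun y => ?_
  have hlt : ‖(z - w) • R‖ < 1 := by
    rw [norm_smul, norm_sub_rev]
    calc ‖w - z‖ * ‖R‖ ≤ ‖w - z‖ * z.re⁻¹ := by gcongr; exact hR.norm_le hA hz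
      _ < 1 := by rwa [← div_eq_mul_inv, div_lt_one hz]
  let U := Units.oneSub _ hlt
  set q : H := (↑U⁻¹ : H →L[ℂ] H) y
  have hq : q - (z - w) • R q = y := by
    have : ((U : H →L[ℂ] H) * (↑U⁻¹ : H →L[ℂ] H)) y = y := by simp
    simpa [U, q] using this
  refine ⟨⟨R q, hR.mem_domain q⟩, ?_⟩
  have h1 := hR.right_inv q
  rw [← hq, eq_sub_iff_add_eq]
  refine Eq.trans ?_ h1
  simp only [sub_smul]
  abel

theorem IsMDissipative.exists_isResolvent [CompleteSpace H] {A : H →ₗ.[ℂ] H}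
    (hA : IsMDissipative A) {z : ℂ} (hz : 0 < z.re) : ∃ R, IsResolvent A z R := by
  obtain ⟨hd, l, hl, hs⟩ := hA
  -- The resolvent at `p > 0` reaches the disc of centre `p` and radius `p`, which contains `3p/2`;
  -- hence it exists at arbitrarily large real points.
  have step : ∀ n : ℕ, ∃ R, IsResolvent A (((3 / 2 : ℝ) ^ n * l : ℝ) : ℂ) R := by
    intro n
    induction n with
    | zero =>
      refine hd.exists_isResolvent (by simpa using hl) fun y => ?_
      obtain ⟨x, hx⟩ := hs y
      exact ⟨x, by simpa using hx⟩
    | succ n ih =>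
      obtain ⟨R, hR⟩ := ih
      have hp : 0 < (3 / 2 : ℝ) ^ n * l := by positivity
      refine hR.exists_of_norm_lt hd (by rw [Complex.ofReal_re]; exact hp)
        (by rw [Complex.ofReal_re]; positivity) ?_
      rw [← Complex.ofReal_sub, Complex.norm_real, Complex.ofReal_re, pow_succ,
        Real.norm_of_nonneg (by nlinarith)]
      nlinarith
  -- The condition `|z - L| < L` is `|z|² < 2 L Re z`, so a large enough `L` puts `z` in the disc
  -- around `L`.
  obtain ⟨n, hn⟩ : ∃ n : ℕ, ‖z‖ ^ 2 / (2 * z.re) / l < (3 / 2 : ℝ) ^ n :=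
    pow_unbounded_of_one_lt _ (by norm_num)
  obtain ⟨R, hR⟩ := step n
  set L : ℝ := (3 / 2 : ℝ) ^ n * l
  have hL : 0 < L := by positivity
  rw [div_lt_iff₀ hl, div_lt_iff₀ (by positivity)] at hn
  refine hR.exists_of_norm_lt hd (by simpa using hL) hz ?_
  rw [Complex.ofReal_re]
  refine lt_of_pow_lt_pow_left₀ 2 hL.le ?_
  rw [Complex.sq_norm, Complex.normSq_apply] at hn ⊢
  simp only [Complex.sub_re, Complex.ofReal_re, Complex.sub_im, Complex.ofReal_im]
  change _ < L * _ at hn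
  nlinarith

/-- The resolvent `(z - A)⁻¹`, with value `0` where it does not exist. -/
noncomputable def resol (A : H →ₗ.[ℂ] H) (z : ℂ) : H →L[ℂ] H :=
  open Classical in if h : ∃ R, IsResolvent A z R then h.choose else 0

variable {A : H →ₗ.[ℂ] H}

theorem opVal_of_mem {x : H} (h : x ∈ A.domain) : opVal A x = A ⟨x, h⟩ := by
  rw [opVal, dif_pos h]

variable [CompleteSpace H]

theorem IsMDissipative.isResolvent (hA : IsMDissipative A) {z : ℂ} (hz : 0 < z.re) :
    IsResolvent A z (resol A z) := by
  have h := hA.exists_isResolvent hz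
  rw [resol, dif_pos h]
  exact h.choose_spec

theorem IsMDissipative.norm_resol_le (hA : IsMDissipative A) {z : ℂ} (hz : 0 < z.re) :
    ‖resol A z‖ ≤ z.re⁻¹ := (hA.isResolvent hz).norm_le hA.1 hz

theorem IsMDissipative.resol_sub (hA : IsMDissipative A) {z w : ℂ} (hz : 0 < z.re)
    (hw : 0 < w.re) : resol A z - resol A w = (w - z) • (resol A z * resol A w) := by
  have h1 := hA.isResolvent hz
  have h2 := hA.isResolvent hw
  ext y
  have := h1.left_inv ⟨resol A w y, h2.mem_domain y⟩
  have e : A ⟨resol A w y, h2.mem_domain y⟩ = w • resol A w y - y := by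
    rw [eq_sub_iff_add_eq, add_comm, ← eq_sub_iff_add_eq, h2.right_inv]
  simp only [e, map_sub, map_smul] at this
  simp only [sub_apply, smul_apply,
    mul_apply_eq_comp]
  conv_lhs => rw [← this]
  rw [sub_smul]
  abel

theorem IsMDissipative.resol_comm (hA : IsMDissipative A) {z w : ℂ} (hz : 0 < z.re)
    (hw : 0 < w.re) : Commute (resol A z) (resol A w) := by
  rcases eq_or_ne z w with rfl | h
  · exact Commute.refl _
  have h1 := hA.resol_sub hz hw
  have h2 := hA.resol_sub hw hz
  have h3 : (w - z) • (resol A z * resol A w) = (w - z) • (resol A w * resol A z) := by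
    rw [← h1, ← neg_sub (resol A w), h2, ← neg_smul, neg_sub]
  exact smul_right_injective _ (sub_ne_zero.2 h.symm) h3

theorem IsMDissipative.continuousAt_resol (hA : IsMDissipative A) {z : ℂ} (hz : 0 < z.re) :
    ContinuousAt (resol A) z := by
  rw [ContinuousAt, tendsto_iff_norm_sub_tendsto_zero]
  have hev : ∀ᶠ w in 𝓝 z, z.re / 2 < w.re :=
    Complex.continuous_re.continuousAt.eventually (lt_mem_nhds (half_lt_self hz))
  have hlim : Tendsto (fun w : ℂ => ‖z - w‖ * ((z.re / 2)⁻¹ * z.re⁻¹)) (𝓝 z) (𝓝 0) := by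
    have : Tendsto (fun w : ℂ => ‖z - w‖ * ((z.re / 2)⁻¹ * z.re⁻¹)) (𝓝 z)
        (𝓝 (‖z - z‖ * ((z.re / 2)⁻¹ * z.re⁻¹))) := by
      refine Continuous.tendsto ?_ z
      fun_prop
    simpa using this
  refine squeeze_zero' (Eventually.of_forall fun _ => norm_nonneg _) ?_ hlim
  filter_upwards [hev] with w hw
  have hw0 : 0 < w.re := (half_pos hz).trans hw
  rw [hA.resol_sub hw0 hz, norm_smul]
  gcongr
  refine (norm_mul_le _ _).trans ?_
  gcongr
  · exact (hA.norm_resol_le hw0).trans (inv_anti₀ (half_pos hz) hw.le)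
  · exact hA.norm_resol_le hz

theorem IsMDissipative.hasDerivAt_resol (hA : IsMDissipative A) {z : ℂ} (hz : 0 < z.re) :
    HasDerivAt (resol A) (-(resol A z * resol A z)) z := by
  rw [hasDerivAt_iff_tendsto_slope]
  have hc : Tendsto (fun w => -(resol A w * resol A z)) (𝓝[≠] z)
      (𝓝 (-(resol A z * resol A z))) :=
    (((hA.continuousAt_resol hz).tendsto.mono_left nhdsWithin_le_nhds).mul_const _).neg
  refine hc.congr' ?_
  have hev : ∀ᶠ w in 𝓝[≠] z, 0 < w.re :=
    (Complex.continuous_re.continuousAt.eventually (lt_mem_nhds hz)).filter_mono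
      nhdsWithin_le_nhds
  filter_upwards [hev, self_mem_nhdsWithin] with w hw hne
  rw [slope_def_module, hA.resol_sub hw hz, smul_smul, ← neg_sub w z, mul_neg,
    inv_mul_cancel₀ (sub_ne_zero.2 hne), neg_one_smul]

theorem IsMDissipative.differentiableAt_resol (hA : IsMDissipative A) {z : ℂ} (hz : 0 < z.re) :
    DifferentiableAt ℂ (resol A) z := (hA.hasDerivAt_resol hz).differentiableAt

theorem IsMDissipative.resol_mem (hA : IsMDissipative A) {z : ℂ} (hz : 0 < z.re) (y : H) :
    resol A z y ∈ A.domain := (hA.isResolvent hz).mem_domain y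

theorem IsMDissipative.opVal_resol (hA : IsMDissipative A) {z : ℂ} (hz : 0 < z.re) (y : H) :
    opVal A (resol A z y) = z • resol A z y - y := by
  rw [opVal_of_mem (hA.resol_mem hz y), eq_sub_iff_add_eq, add_comm, ← eq_sub_iff_add_eq,
    (hA.isResolvent hz).right_inv]

theorem IsMDissipative.resol_sub_opVal (hA : IsMDissipative A) {z : ℂ} (hz : 0 < z.re) {x : H}
    (hx : x ∈ A.domain) : z • resol A z x - resol A z (opVal A x) = x := by
  have := (hA.isResolvent hz).left_inv ⟨x, hx⟩
  rwa [← opVal_of_mem hx, map_sub, map_smul] at this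

/-- A bounded operator commuting with a resolvent leaves the domain invariant. -/
theorem IsMDissipative.mem_domain_of_commute (hA : IsMDissipative A) {T : H →L[ℂ] H}
    (hT : Commute T (resol A 1)) {x : H} (hx : x ∈ A.domain) :
    T x ∈ A.domain ∧ opVal A (T x) = T (opVal A x) := by
  have h1 : (0 : ℝ) < (1 : ℂ).re := by simp
  have h := hA.resol_sub_opVal h1 hx
  -- Write `x` as the resolvent of `x - Ax` and move `T` inside; the image then visibly lies in the
  -- domain.
  have e : T x = resol A 1 (T (x - opVal A x)) := by
    have := congrArg (fun B : H →L[ℂ] H => B (x - opVal A x)) hT.eq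
    simp only [mul_apply_eq_comp] at this
    rw [← this, map_sub (resol A 1)]
    rw [one_smul] at h
    rw [h]
  refine ⟨by rw [e]; exact hA.resol_mem h1 _, ?_⟩
  rw [e, hA.opVal_resol h1, one_smul, ← e, map_sub]
  abel

/-- If `y` is orthogonal to the domain and `x = (1 - A)⁻¹ y`, then `0 = Re ⟨x, y⟩ = ‖x‖² - Re ⟨x,
Ax⟩ ≥ ‖x‖²`, so `y = 0`. -/
theorem IsMDissipative.dense_domain (hA : IsMDissipative A) :
    Dense (A.domain : Set H) := by
  rw [Submodule.dense_iff_topologicalClosure_eq_top, Submodule.topologicalClosure_eq_top_iff,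
    Submodule.eq_bot_iff]
  intro y hy
  have h1 : (0 : ℝ) < (1 : ℂ).re := by simp
  have hr := hA.isResolvent h1
  set x : A.domain := ⟨resol A 1 y, hr.mem_domain y⟩
  have e : (x : H) - A x = y := by simpa using hr.right_inv y
  have h0 : inner ℂ (x : H) y = 0 := (Submodule.mem_orthogonal _ _).1 hy x x.2
  rw [← e, inner_sub_right, inner_self_eq_norm_sq_to_K] at h0
  have h2 := congrArg Complex.re h0
  have h3 := hA.1 x
  have h4 : (((‖(x : H)‖ : ℂ)) ^ 2).re = ‖(x : H)‖ ^ 2 := by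
    rw [← Complex.ofReal_pow, Complex.ofReal_re]
  simp only [Complex.coe_algebraMap, Complex.sub_re, Complex.zero_re] at h2
  have h5 : ‖(x : H)‖ = 0 := by
    have := norm_nonneg (x : H)
    nlinarith
  have h6 : x = 0 := Subtype.ext (by simpa using h5)
  rw [← e, h6]; simp

end Resolvent

/-! ### Convolution on the half-line and its associativity. -/

section Convolution

open scoped Convolution
open ContinuousLinearMap (lsmul mul)

variable {E F G E₁ E₂ E₃ : Type*}
  [NormedAddCommGroup E] [NormedSpace ℝ E] [NormedAddCommGroup F] [NormedSpace ℝ F]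
  [NormedAddCommGroup G] [NormedSpace ℝ G] [NormedAddCommGroup E₁] [NormedSpace ℝ E₁]
  [NormedAddCommGroup E₂] [NormedSpace ℝ E₂] [NormedAddCommGroup E₃] [NormedSpace ℝ E₃]

/-- The convolution on the half-line with respect to a bilinear map. -/
noncomputable def bconv (L : E →L[ℝ] F →L[ℝ] G) (f : ℝ → E) (g : ℝ → F) (t : ℝ) : G :=
  ∫ s in (0 : ℝ)..t, L (f (t - s)) (g s)

/-- Causality: up to time `T` only the values on `(0, T]` matter, so the theory of convolution on
the whole line applies to locally integrable functions after truncation. The integral is taken over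
the open interval because at `s = t` the truncated factor vanishes. -/
theorem convolution_indicator_left (L : E →L[ℝ] F →L[ℝ] G) (f : ℝ → E) {K : ℝ → F}
    (hK : ∀ s ≤ 0, K s = 0) {t T : ℝ} (ht : 0 < t) (htT : t ≤ T) :
    ((Ioc 0 T).indicator f ⋆[L] K) t = bconv L f K t := by
  rw [convolution_eq_swap, bconv, intervalIntegral.integral_of_le ht.le,
    integral_Ioc_eq_integral_Ioo, ← integral_indicator measurableSet_Ioo]
  congr 1 with s
  by_cases hs : s ∈ Ioo 0 t
  · have hts : t - s ∈ Ioc 0 T := ⟨sub_pos.2 hs.2, by linarith [hs.1]⟩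
    rw [indicator_of_mem hs, indicator_of_mem hts]
  · rw [indicator_of_notMem hs]
    rcases le_or_gt s 0 with h | h
    · rw [hK s h, map_zero]
    · have : t ≤ s := by
        by_contra! hc
        exact hs ⟨h, hc⟩
      rw [indicator_of_notMem (fun h' => absurd h'.1 (by linarith)), map_zero, zero_apply]

theorem convolution_indicator_right (L : E →L[ℝ] F →L[ℝ] G) {K : ℝ → E} (g : ℝ → F)
    (hK : ∀ s ≤ 0, K s = 0) {t T : ℝ} (ht : 0 < t) (htT : t ≤ T) :
    (K ⋆[L] (Ioc 0 T).indicator g) t = bconv L K g t := by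
  rw [convolution_eq_swap, bconv, intervalIntegral.integral_of_le ht.le,
    integral_Ioc_eq_integral_Ioo, ← integral_indicator measurableSet_Ioo]
  congr 1 with s
  by_cases hs : s ∈ Ioo 0 t
  · have hsT : s ∈ Ioc 0 T := ⟨hs.1, by linarith [hs.2]⟩
    rw [indicator_of_mem hs, indicator_of_mem hsT]
  · rw [indicator_of_notMem hs]
    rcases le_or_gt s 0 with h | h
    · rw [indicator_of_notMem (fun h' => absurd h'.1 (by linarith)), map_zero]
    · have : t ≤ s := by
        by_contra! hc
        exact hs ⟨h, hc⟩
      rw [hK _ (by linarith), map_zero, zero_apply]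

theorem indicator_Ioc_of_nonpos {V : Type*} [Zero V] (f : ℝ → V) (T : ℝ) {s : ℝ} (hs : s ≤ 0) :
    (Ioc 0 T).indicator f s = 0 :=
  indicator_of_notMem (fun h => absurd h.1 (by linarith)) _

theorem convolution_indicator (L : E →L[ℝ] F →L[ℝ] G) (f : ℝ → E) (g : ℝ → F)
    {t T : ℝ} (ht : 0 < t) (htT : t ≤ T) :
    ((Ioc 0 T).indicator f ⋆[L] (Ioc 0 T).indicator g) t = bconv L f g t := by
  rw [convolution_indicator_left L f (fun s hs => indicator_Ioc_of_nonpos g T hs) ht htT]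
  refine intervalIntegral.integral_congr_ae (Eventually.of_forall fun s hs => ?_)
  rw [uIoc_of_le ht.le] at hs
  have hsT : s ∈ Ioc 0 T := ⟨hs.1, hs.2.trans htT⟩
  simp only [indicator_of_mem hsT]

theorem convolution_indicator_of_nonpos (L : E →L[ℝ] F →L[ℝ] G) (f : ℝ → E) (g : ℝ → F)
    {t T : ℝ} (ht : t ≤ 0) :
    ((Ioc 0 T).indicator f ⋆[L] (Ioc 0 T).indicator g) t = 0 := by
  rw [convolution_eq_swap]
  refine integral_eq_zero_of_ae (Eventually.of_forall fun s => ?_)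
  rcases le_or_gt s 0 with h | h
  · simp [indicator_Ioc_of_nonpos g T h]
  · simp [indicator_Ioc_of_nonpos f T (show t - s ≤ 0 by linarith)]

theorem bconv_congr (L : E →L[ℝ] F →L[ℝ] G) {f f' : ℝ → E} {g g' : ℝ → F} {t : ℝ} (ht : 0 ≤ t)
    (hf : ∀ s ∈ Ioo 0 t, f s = f' s) (hg : ∀ s ∈ Ioo 0 t, g s = g' s) :
    bconv L f g t = bconv L f' g' t := by
  rw [bconv, bconv, intervalIntegral.integral_of_le ht, intervalIntegral.integral_of_le ht,
    integral_Ioc_eq_integral_Ioo, integral_Ioc_eq_integral_Ioo]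
  refine setIntegral_congr_fun measurableSet_Ioo fun s hs => ?_
  rw [hf _ ⟨sub_pos.2 hs.2, by linarith [hs.1]⟩, hg s hs]

theorem integrableOn_bconv (L : E →L[ℝ] F →L[ℝ] G) {f : ℝ → E} {g : ℝ → F} {t : ℝ}
    (hf : IntegrableOn f (Ioc 0 t)) (hg : IntegrableOn g (Ioc 0 t)) :
    IntegrableOn (bconv L f g) (Ioc 0 t) := by
  rw [← integrable_indicator_iff measurableSet_Ioc] at hf hg
  refine (hf.integrable_convolution L hg).integrableOn.congr_fun (fun s hs => ?_)
    measurableSet_Ioc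
  exact convolution_indicator L f g hs.1 hs.2

/-- Convolutions of integrable functions exist only almost everywhere, whereas equality is needed at
the given `t`. Fubini at `t` needs `|f| * (|g| * |h|)` to be finite there; `hb` ensures it by
bounding one of the two factors, the other being integrable. -/
theorem bconv_assoc [CompleteSpace E₁] [CompleteSpace E₂] [CompleteSpace E₃] [CompleteSpace E]
    [CompleteSpace F] [CompleteSpace G]
    (L₁ : E₁ →L[ℝ] E₂ →L[ℝ] E) (L₂ : E →L[ℝ] E₃ →L[ℝ] F)
    (L₃ : E₁ →L[ℝ] G →L[ℝ] F) (L₄ : E₂ →L[ℝ] E₃ →L[ℝ] G)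
    (hL : ∀ x y z, L₂ (L₁ x y) z = L₃ x (L₄ y z))
    {f : ℝ → E₁} {g : ℝ → E₂} {h : ℝ → E₃} {t : ℝ} (ht : 0 < t)
    (hf : IntegrableOn f (Ioc 0 t)) (hg : IntegrableOn g (Ioc 0 t))
    (hh : IntegrableOn h (Ioc 0 t))
    (hb : (∃ M : ℝ, ∀ s ∈ Ioo 0 t, ‖f s‖ ≤ M) ∨
      ∃ M : ℝ, ∀ s ∈ Ioo 0 t, ∫ r in (0 : ℝ)..s, ‖g (s - r)‖ * ‖h r‖ ≤ M) :
    bconv L₂ (bconv L₁ f g) h t = bconv L₃ f (bconv L₄ g h) t := by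
  rw [← integrable_indicator_iff measurableSet_Ioc] at hf hg hh
  have e1 : bconv L₂ (bconv L₁ f g) h t =
      (((Ioc 0 t).indicator f ⋆[L₁] (Ioc 0 t).indicator g) ⋆[L₂] (Ioc 0 t).indicator h) t := by
    rw [convolution_indicator_right L₂ h
      (fun s hs => convolution_indicator_of_nonpos L₁ f g hs) ht le_rfl]
    exact bconv_congr L₂ ht.le
      (fun s hs => (convolution_indicator L₁ f g hs.1 hs.2.le).symm) fun _ _ => rfl
  have e2 : bconv L₃ f (bconv L₄ g h) t =
      ((Ioc 0 t).indicator f ⋆[L₃] ((Ioc 0 t).indicator g ⋆[L₄] (Ioc 0 t).indicator h)) t := by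
    rw [convolution_indicator_left L₃ f
      (fun s hs => convolution_indicator_of_nonpos L₄ g h hs) ht le_rfl]
    exact bconv_congr L₃ ht.le (fun _ _ => rfl)
      (fun s hs => (convolution_indicator L₄ g h hs.1 hs.2.le).symm)
  rw [e1, e2]
  have eg : (fun x => ‖(Ioc 0 t).indicator g x‖) = (Ioc 0 t).indicator fun x => ‖g x‖ :=
    funext fun x => norm_indicator_eq_indicator_norm _ _
  have eh : (fun x => ‖(Ioc 0 t).indicator h x‖) = (Ioc 0 t).indicator fun x => ‖h x‖ :=
    funext fun x => norm_indicator_eq_indicator_norm _ _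
  set N : ℝ → ℝ := (fun x => ‖(Ioc 0 t).indicator g x‖) ⋆[mul ℝ ℝ]
    (fun x => ‖(Ioc 0 t).indicator h x‖) with hN
  have hNi : Integrable N := hg.norm.integrable_convolution (mul ℝ ℝ) hh.norm
  have hN0 : ∀ s, 0 ≤ N s := fun s => integral_nonneg fun r => by
    simp only [ContinuousLinearMap.mul_apply']; positivity
  have hNneg : ∀ s ≤ 0, N s = 0 := by
    intro s hs
    rw [hN, eg, eh]
    exact convolution_indicator_of_nonpos (mul ℝ ℝ) _ _ hs
  refine convolution_assoc L₁ L₂ L₃ L₄ hL hf.aestronglyMeasurable hg.aestronglyMeasurable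
    hh.aestronglyMeasurable (hf.ae_convolution_exists L₁ hg)
    (hg.norm.ae_convolution_exists _ hh.norm) ?_
  have hmeas : AEStronglyMeasurable (fun s => ‖(Ioc 0 t).indicator f s‖ * N (t - s)) :=
    hf.aestronglyMeasurable.norm.mul (hNi.comp_sub_left t).aestronglyMeasurable
  change Integrable (fun s => ‖(Ioc 0 t).indicator f s‖ * N (t - s))
  rcases hb with ⟨M, hM⟩ | ⟨M, hM⟩
  · refine ((hNi.comp_sub_left t).const_mul M).mono' hmeas ?_
    have hne : ∀ᵐ s : ℝ, s ≠ t := by simp [ae_iff]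
    filter_upwards [hne] with s hst
    rw [Real.norm_of_nonneg (mul_nonneg (norm_nonneg _) (hN0 _))]
    by_cases hs : s ∈ Ioc 0 t
    · rw [indicator_of_mem hs]
      exact mul_le_mul_of_nonneg_right (hM s ⟨hs.1, hs.2.lt_of_ne hst⟩) (hN0 _)
    · rw [indicator_of_notMem hs, norm_zero, zero_mul]
      have hM0 : 0 ≤ M := (norm_nonneg _).trans (hM (t / 2) ⟨by linarith, by linarith⟩)
      exact mul_nonneg hM0 (hN0 _)
  · refine (hf.norm.const_mul M).mono' hmeas (Eventually.of_forall fun s => ?_)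
    rw [Real.norm_of_nonneg (mul_nonneg (norm_nonneg _) (hN0 _)), mul_comm]
    by_cases hs : s ∈ Ioo 0 t
    · refine mul_le_mul_of_nonneg_right ?_ (norm_nonneg _)
      have hts : t - s ∈ Ioo 0 t := ⟨by linarith [hs.2], by linarith [hs.1]⟩
      refine le_trans (le_of_eq ?_) (hM (t - s) hts)
      rw [hN, eg, eh]
      exact convolution_indicator (mul ℝ ℝ) _ _ hts.1 hts.2.le
    · rcases le_or_gt s 0 with h0 | h0
      · simp [indicator_Ioc_of_nonpos f t h0]
      · have : t ≤ s := by
          by_contra! hc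
          exact hs ⟨h0, hc⟩
        rw [hNneg _ (by linarith), zero_mul]
        have hM0 : 0 ≤ M := by
          refine le_trans ?_ (hM (t / 2) ⟨by linarith, by linarith⟩)
          exact intervalIntegral.integral_nonneg (by linarith) fun _ _ => by positivity
        exact mul_nonneg hM0 (norm_nonneg _)

theorem bconv_lsmul (k : ℝ → ℝ) (w : ℝ → E) : bconv (lsmul ℝ ℝ) k w = conv k w := rfl

theorem conv_one (w : ℝ → E) (t : ℝ) :
    conv (fun _ => 1) w t = ∫ s in (0 : ℝ)..t, w s := by
  simp [conv]


theorem conv_const_one (k : ℝ → ℝ) (t : ℝ) :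
    conv k (fun _ => (1 : ℝ)) t = ∫ s in (0 : ℝ)..t, k s := by
  simp [conv, intervalIntegral.integral_comp_sub_left]

/-- Convolution commutes with integration from `0`. -/
theorem conv_integral [CompleteSpace E] {k : ℝ → ℝ} {w : ℝ → E} {t : ℝ} (ht : 0 < t)
    (hk : IntegrableOn k (Ioc 0 t)) (hw : IntegrableOn w (Ioc 0 t)) :
    conv k (fun s => ∫ r in (0 : ℝ)..s, w r) t = ∫ s in (0 : ℝ)..t, conv k w s := by
  have h1 : IntegrableOn (fun _ : ℝ => (1 : ℝ)) (Ioc 0 t) := by simp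
  have hL : ∀ (x y : ℝ) (z : E), lsmul ℝ ℝ (lsmul ℝ ℝ x y) z
      = lsmul ℝ ℝ x (lsmul ℝ ℝ y z) := fun x y z => smul_assoc x y z
  -- Integration is convolution with `1`, and `k * 1 = 1 * k`; bracketing `k * 1 * w` and `1 * k *
  -- w` both ways gives the claim.
  have a := bconv_assoc _ _ _ _ hL ht hk h1 hw (Or.inr ⟨∫ r in (0 : ℝ)..t, ‖w r‖, fun s hs => by
    simp only [norm_one, one_mul]
    refine intervalIntegral.integral_mono_interval le_rfl hs.1.le hs.2.le
      (Eventually.of_forall fun _ => norm_nonneg _) ?_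
    rw [intervalIntegrable_iff_integrableOn_Ioc_of_le ht.le]
    exact hw.norm⟩)
  have b := bconv_assoc _ _ _ _ hL ht h1 hk hw (Or.inl ⟨1, by simp⟩)
  simp only [bconv_lsmul] at a b
  simp only [← conv_one w, ← conv_one (conv k w)]
  rw [← a, ← b]
  congr 1 with s
  rw [conv_one, conv_const_one]

end Convolution

/-! ### Laplace transforms of convolutions, and injectivity of the transform. -/

section Laplace

open ContinuousLinearMap (lsmul)

variable {E : Type*} [NormedAddCommGroup E] [NormedSpace ℝ E]

/-- As `e^{-μt} = e^{-μs} e^{-μ(t-s)}`, exponential weights pass through the convolution; the left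
side has the form used by `posConvolution`. -/
theorem exp_smul_conv (k : ℝ → ℝ) (p : ℝ → E) (μ t : ℝ) :
    ∫ s in (0 : ℝ)..t, lsmul ℝ ℝ (Real.exp (-μ * s) * k s) (Real.exp (-μ * (t - s)) • p (t - s))
      = Real.exp (-μ * t) • conv k p t := by
  have h := intervalIntegral.integral_comp_sub_left (fun s => k (t - s) • p s) t (a := 0) (b := t)
  simp only [sub_sub_cancel, sub_self, sub_zero] at h
  rw [conv, ← h, ← intervalIntegral.integral_smul]
  congr 1 with s
  rw [ContinuousLinearMap.lsmul_apply, smul_smul, smul_smul]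
  congr 1
  rw [show -μ * t = -μ * s + -μ * (t - s) by ring, Real.exp_add]
  ring

theorem integrableOn_laplace_conv {k : ℝ → ℝ} {p : ℝ → E} {μ : ℝ}
    (hk : IntegrableOn (fun t => Real.exp (-μ * t) * k t) (Ioi 0))
    (hp : IntegrableOn (fun t => Real.exp (-μ * t) • p t) (Ioi 0)) :
    IntegrableOn (fun t => Real.exp (-μ * t) • conv k p t) (Ioi 0) := by
  have h := integrable_posConvolution hk hp (lsmul ℝ ℝ)
  refine h.integrableOn.congr_fun (fun t ht => ?_) measurableSet_Ioi
  rw [posConvolution, indicator_of_mem ht]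
  exact exp_smul_conv k p μ t

variable [CompleteSpace E]

theorem laplace_conv {k : ℝ → ℝ} {p : ℝ → E} {μ : ℝ}
    (hk : IntegrableOn (fun t => Real.exp (-μ * t) * k t) (Ioi 0))
    (hp : IntegrableOn (fun t => Real.exp (-μ * t) • p t) (Ioi 0)) :
    ∫ t in Ioi 0, Real.exp (-μ * t) • conv k p t =
      (∫ t in Ioi 0, Real.exp (-μ * t) * k t) • ∫ t in Ioi 0, Real.exp (-μ * t) • p t := by
  have h := integral_posConvolution hk hp (lsmul ℝ ℝ)
  rw [ContinuousLinearMap.lsmul_apply] at h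
  rw [← h]
  exact setIntegral_congr_fun measurableSet_Ioi fun t _ => (exp_smul_conv k p μ t).symm

/-- A continuous function on the half-line is determined by the values of its Laplace transform at
the positive integers. -/
theorem eq_zero_of_laplace_eq_zero {f : ℝ → E} (hf : ContinuousOn f (Ioi 0))
    (hi : IntegrableOn (fun t => Real.exp (-t) • f t) (Ioi 0))
    (h : ∀ n : ℕ, ∫ t in Ioi 0, Real.exp (-((n : ℝ) + 1) * t) • f t = 0) :
    ∀ t, 0 < t → f t = 0 := by
  set F : ℝ → E := fun t => Real.exp (-t) • f t with hF
  have hFc : ContinuousOn F (Ioi 0) := by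
    refine ContinuousOn.smul (Continuous.continuousOn ?_) hf
    fun_prop
  have hexp : ∀ t ∈ Ioi (0 : ℝ), Real.exp (-t) ∈ Icc (0 : ℝ) 1 := fun t ht =>
    ⟨(Real.exp_pos _).le, Real.exp_le_one_iff.2 (by linarith [mem_Ioi.1 ht])⟩
  -- In the variable `y = e^{-t} ∈ [0, 1]` the hypotheses say that all moments of `F` vanish.
  have hmono : ∀ n : ℕ, ∫ t in Ioi 0, (Real.exp (-t)) ^ n • F t = 0 := by
    intro n
    rw [← h n]
    refine setIntegral_congr_fun measurableSet_Ioi fun t _ => ?_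
    simp only [hF, smul_smul, ← Real.exp_nat_mul, ← Real.exp_add]
    congr 2
    ring
  have hpi : ∀ φ : ℝ → ℝ, ContinuousOn φ (Icc 0 1) →
      IntegrableOn (fun t => φ (Real.exp (-t)) • F t) (Ioi 0) := by
    intro φ hφ
    obtain ⟨C, hC⟩ := isCompact_Icc.exists_bound_of_continuousOn hφ
    refine Integrable.bdd_smul (C := C) hi ?_ ?_
    · refine ContinuousOn.aestronglyMeasurable ?_ measurableSet_Ioi
      exact hφ.comp (by fun_prop) hexp
    · exact (ae_restrict_iff' measurableSet_Ioi).2 (Eventually.of_forall fun t ht => hC _ (hexp t ht))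
  have hpoly : ∀ p : Polynomial ℝ, ∫ t in Ioi 0, p.eval (Real.exp (-t)) • F t = 0 := by
    intro p
    induction p using Polynomial.induction_on' with
    | add p q hp hq =>
      simp only [Polynomial.eval_add, add_smul]
      rw [integral_add (hpi _ p.continuous.continuousOn) (hpi _ q.continuous.continuousOn), hp, hq,
        add_zero]
    | monomial n a =>
      simp only [Polynomial.eval_monomial, mul_smul]
      rw [integral_smul, hmono, smul_zero]
  -- Weierstrass approximation, with `F` integrable; the tolerance `ε / (I + 1)` avoids dividing by
  -- `I = 0`.
  have hcont : ∀ φ : ℝ → ℝ, ContinuousOn φ (Icc 0 1) →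
      ∫ t in Ioi 0, φ (Real.exp (-t)) • F t = 0 := by
    intro φ hφ
    rw [← norm_le_zero_iff]
    refine le_of_forall_pos_le_add fun ε hε => ?_
    set I := ∫ t in Ioi 0, ‖F t‖
    have hI : 0 ≤ I := integral_nonneg fun _ => norm_nonneg _
    obtain ⟨p, hp⟩ := exists_polynomial_near_of_continuousOn 0 1 φ hφ (ε / (I + 1)) (by positivity)
    have e : ∫ t in Ioi 0, φ (Real.exp (-t)) • F t =
        ∫ t in Ioi 0, (φ (Real.exp (-t)) - p.eval (Real.exp (-t))) • F t := by
      simp only [sub_smul]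
      rw [integral_sub (hpi _ hφ) (hpi _ p.continuous.continuousOn), hpoly, sub_zero]
    rw [e, zero_add]
    calc ‖∫ t in Ioi 0, (φ (Real.exp (-t)) - p.eval (Real.exp (-t))) • F t‖
        ≤ ∫ t in Ioi 0, ε / (I + 1) * ‖F t‖ := by
          refine norm_integral_le_of_norm_le (hi.norm.const_mul _) ?_
          refine (ae_restrict_iff' measurableSet_Ioi).2 (Eventually.of_forall fun t ht => ?_)
          rw [norm_smul, Real.norm_eq_abs, abs_sub_comm]
          exact mul_le_mul_of_nonneg_right (hp _ (hexp t ht)).le (norm_nonneg _)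
      _ = ε / (I + 1) * I := integral_const_mul _ _
      _ ≤ ε := by
          rw [div_mul_eq_mul_div, div_le_iff₀ (by positivity)]
          nlinarith
  have hae : ∀ᵐ t : ℝ, t ∈ Ioi (0 : ℝ) → F t = 0 := by
    refine isOpen_Ioi.ae_eq_zero_of_integral_contDiff_smul_eq_zero
      hi.locallyIntegrableOn fun g hg hgc hgs => ?_
    -- A test function `g` supported in `(0, ∞)` is a function of `y = e^{-t}`, continuous up to `y
    -- = 0` because `g` vanishes for large times.
    have hφ : ContinuousOn (fun y => g (-Real.log y)) (Icc 0 1) := by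
      intro y hy
      refine ContinuousAt.continuousWithinAt ?_
      rcases eq_or_ne y 0 with rfl | hy0
      · obtain ⟨b, hb⟩ := hgc.isCompact.bddAbove
        have hz : ∀ x, b < x → g x = 0 := fun x hx => by
          by_contra hne
          exact absurd (hb (subset_tsupport g hne)) (by simpa using hx)
        -- At `y = 0` the convention `Real.log 0 = 0` produces the value `g 0`, which has to agree
        -- with the limit `0`.
        have h0 : g 0 = 0 := by
          by_contra hne
          exact absurd (hgs (subset_tsupport g hne)) (by simp)
        have hev : (fun y => g (-Real.log y)) =ᶠ[𝓝 0] fun _ => 0 := by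
          have : ∀ᶠ y : ℝ in 𝓝[≠] 0, b < -Real.log y :=
            (tendsto_neg_atBot_atTop.comp Real.tendsto_log_nhdsNE_zero).eventually_gt_atTop b
          rw [eventually_nhdsWithin_iff] at this
          filter_upwards [this] with y hy
          rcases eq_or_ne y 0 with rfl | h
          · simpa using h0
          · exact hz _ (hy h)
        exact continuousAt_const.congr hev.symm
      · exact (hg.continuous.continuousAt).comp (Real.continuousAt_log hy0).neg
    have := hcont _ hφ
    simp only [Real.log_exp, neg_neg] at this
    rw [← this, ← integral_indicator measurableSet_Ioi]
    congr 1 with t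
    by_cases ht : t ∈ Ioi (0 : ℝ)
    · rw [indicator_of_mem ht]
    · rw [indicator_of_notMem ht]
      have : g t = 0 := by
        by_contra hne
        exact ht (hgs (subset_tsupport g hne))
      rw [this, zero_smul]
  have hEq : EqOn F 0 (Ioi 0) := Measure.eqOn_open_of_ae_eq
    ((ae_restrict_iff' measurableSet_Ioi).2 hae) isOpen_Ioi hFc continuousOn_const
  intro t ht
  have := hEq (mem_Ioi.2 ht)
  simpa [hF, Real.exp_ne_zero] using this

end Laplace

/-! ### Cauchy's integral formula on a sector, in the logarithmic variable. -/

section Strip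

open Complex

/-- With `w = e^{x+iy}` the integrand is `w/(1+w) + w/(μ-w)`, with primitive `log (1+w) - log
(μ-w)`. Since `sin y ≠ 0`, both arguments stay off the real axis, hence off the cut. -/
theorem tendsto_log_sub_log {μ : ℝ} (hμ : 0 < μ) {y : ℝ} (hy : Real.sin y ≠ 0) :
    Tendsto (fun N : ℝ => ∫ x in (-N)..N,
        (1 + μ) * exp (x + y * I) / ((μ - exp (x + y * I)) * (1 + exp (x + y * I)))) atTop
      (𝓝 (log (exp (y * I)) - log (-exp (y * I)) + log μ)) := by
  have him : ∀ x : ℝ, (exp (x + y * I)).im ≠ 0 := fun x => by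
    rw [exp_im]
    simpa using hy
  have h1 : ∀ x : ℝ, 1 + exp (x + y * I) ∈ slitPlane := fun x => Or.inr (by simpa using him x)
  have h2 : ∀ x : ℝ, μ - exp (x + y * I) ∈ slitPlane := fun x => Or.inr (by simpa using him x)
  have hd : ∀ x : ℝ, HasDerivAt (fun x : ℝ => log (1 + exp (x + y * I)) - log (μ - exp (x + y * I)))
      ((1 + μ) * exp (x + y * I) / ((μ - exp (x + y * I)) * (1 + exp (x + y * I)))) x := by
    intro x
    have he : HasDerivAt (fun x : ℝ => exp (x + y * I)) (exp (x + y * I)) x := by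
      have h := ((hasDerivAt_id (x : ℂ)).add_const (y * I)).cexp
      have h' := h.comp_ofReal
      simpa using h'
    have a := (he.const_add 1).clog_real (h1 x)
    have b := (he.const_sub (μ : ℂ)).clog_real (h2 x)
    convert! a.sub b using 1
    have n1 := slitPlane_ne_zero (h1 x)
    have n2 := slitPlane_ne_zero (h2 x)
    field_simp
    ring
  have hcont : Continuous (fun x : ℝ =>
      (1 + μ) * exp (x + y * I) / ((μ - exp (x + y * I)) * (1 + exp (x + y * I)))) := by
    refine Continuous.div (by fun_prop) (by fun_prop) fun x => ?_
    exact mul_ne_zero (slitPlane_ne_zero (h2 x)) (slitPlane_ne_zero (h1 x))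
  have hint : ∀ N : ℝ, ∫ x in (-N)..N,
        (1 + μ) * exp (x + y * I) / ((μ - exp (x + y * I)) * (1 + exp (x + y * I))) =
      (log (exp (-N : ℝ) + exp (y * I)) - log (μ * exp (-N : ℝ) - exp (y * I)))
      - (log (1 + exp ((-N : ℝ) + y * I)) - log (μ - exp ((-N : ℝ) + y * I))) := by
    intro N
    rw [intervalIntegral.integral_eq_sub_of_hasDerivAt (fun x _ => hd x)
      (hcont.intervalIntegrable _ _)]
    congr 1
    -- Both logarithms grow like `N`; pulling the positive factor `e^N` out of each cancels the
    -- growth.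
    have e1 : 1 + exp (N + y * I) = (Real.exp N : ℝ) * (exp (-N : ℝ) + exp (y * I)) := by
      rw [exp_add, ofReal_exp, mul_add, ofReal_neg, exp_neg, mul_inv_cancel₀ (exp_ne_zero _)]
    have e2 : μ - exp (N + y * I) = (Real.exp N : ℝ) * (μ * exp (-N : ℝ) - exp (y * I)) := by
      rw [exp_add, ofReal_exp, mul_sub, mul_left_comm, ofReal_neg, exp_neg,
        mul_inv_cancel₀ (exp_ne_zero _), mul_one]
    have m1 : exp (-N : ℝ) + exp (y * I) ≠ 0 := fun h0 =>
      slitPlane_ne_zero (h1 N) (by rw [e1, h0, mul_zero])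
    have m2 : μ * exp (-N : ℝ) - exp (y * I) ≠ 0 := fun h0 =>
      slitPlane_ne_zero (h2 N) (by rw [e2, h0, mul_zero])
    rw [e1, e2, log_ofReal_mul (Real.exp_pos _) m1, log_ofReal_mul (Real.exp_pos _) m2]
    ring
  simp only [hint]
  have hexp : Tendsto (fun N : ℝ => exp ((-N : ℝ) : ℂ)) atTop (𝓝 0) := by
    rw [tendsto_zero_iff_norm_tendsto_zero]
    simp only [norm_exp, ofReal_re]
    exact Real.tendsto_exp_neg_atTop_nhds_zero
  have hexp' : Tendsto (fun N : ℝ => exp ((-N : ℝ) + y * I)) atTop (𝓝 0) := by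
    simp only [exp_add]
    simpa using hexp.mul_const (exp (y * I))
  have s1 : exp (y * I) ∈ slitPlane := Or.inr (by simpa using him 0)
  have s2 : -exp (y * I) ∈ slitPlane := Or.inr (by simpa using him 0)
  have t1 : Tendsto (fun N : ℝ => log (exp (-N : ℝ) + exp (y * I))) atTop
      (𝓝 (log (exp (y * I)))) := by
    refine Tendsto.clog ?_ s1
    simpa using hexp.add_const (exp (y * I))
  have t2 : Tendsto (fun N : ℝ => log (μ * exp (-N : ℝ) - exp (y * I))) atTop
      (𝓝 (log (-exp (y * I)))) := by
    refine Tendsto.clog ?_ s2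
    simpa using (hexp.const_mul (μ : ℂ)).sub_const (exp (y * I))
  have t3 : Tendsto (fun N : ℝ => log (1 + exp ((-N : ℝ) + y * I))) atTop (𝓝 (log 1)) := by
    refine Tendsto.clog ?_ one_mem_slitPlane
    simpa using hexp'.const_add 1
  have t4 : Tendsto (fun N : ℝ => log (μ - exp ((-N : ℝ) + y * I))) atTop (𝓝 (log μ)) := by
    refine Tendsto.clog ?_ (ofReal_mem_slitPlane.2 hμ)
    simpa using hexp'.const_sub (μ : ℂ)
  have := (t1.sub t2).sub (t3.sub t4)
  rw [log_one, zero_sub, sub_neg_eq_add] at this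
  exact this

/-- On the principal branch `-e^{±iθ}` has argument `±(θ - π)`. The jumps `±πi` on the two edges add
up to the `2πi` of Cauchy's formula. -/
theorem log_exp_sub_log_neg_exp {θ : ℝ} (h0 : 0 < θ) (hπ : θ < Real.pi) :
    log (exp (θ * I)) - log (-exp (θ * I)) = Real.pi * I ∧
    log (exp ((-θ : ℝ) * I)) - log (-exp ((-θ : ℝ) * I)) = -(Real.pi * I) := by
  have e1 : -exp (θ * I) = exp ((θ - Real.pi : ℝ) * I) := by
    push_cast
    rw [sub_mul, exp_sub, exp_pi_mul_I, div_neg, div_one]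
  have e2 : -exp ((-θ : ℝ) * I) = exp ((Real.pi - θ : ℝ) * I) := by
    rw [show ((Real.pi - θ : ℝ) : ℂ) * I = (-θ : ℝ) * I + Real.pi * I by push_cast; ring,
      exp_add, exp_pi_mul_I, mul_neg_one]
  have key : ∀ a : ℝ, -Real.pi < a → a ≤ Real.pi → log (exp (a * I)) = a * I := fun a h1 h2 =>
    log_exp (by simpa using h1) (by simpa using h2)
  rw [e1, e2, key _ (by linarith) (by linarith), key _ (by linarith) (by linarith),
    key _ (by linarith) (by linarith), key _ (by linarith) (by linarith)]
  constructor <;> push_cast <;> ring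

theorem exp_ne_ofReal {μ θ : ℝ} (hμ : 0 < μ) (hπ : θ < Real.pi) {z : ℂ} (hz : |z.im| ≤ θ)
    (hne : z ≠ Real.log μ) : exp z ≠ μ := by
  intro h
  apply hne
  have h2 := abs_le.1 hz
  rw [← log_exp (x := z) (by linarith) (by linarith), h, ofReal_log hμ.le]

theorem one_add_exp_ne_zero {θ : ℝ} (hπ : θ < Real.pi) {z : ℂ} (hz : |z.im| ≤ θ) :
    1 + exp z ≠ 0 := by
  intro h
  have h1 : exp z = -1 := by linear_combination h
  have h2 := abs_le.1 hz
  have h3 := log_exp (x := z) (by linarith) (by linarith)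
  rw [h1, log_neg_one] at h3
  have := congrArg Complex.im h3
  simp at this
  linarith

variable {E : Type*} [NormedAddCommGroup E] [NormedSpace ℂ E] [CompleteSpace E]

/-- Cauchy's integral formula on the sector `|arg w| ≤ θ`, in the logarithmic variable
`w = e ^ z`. -/
theorem strip_integral_sub {μ θ α C : ℝ} (hμ : 0 < μ) (h0 : 0 < θ) (hπ : θ < Real.pi)
    (hα0 : 0 < α) (hα1 : α < 1) {G : ℂ → E}
    (hG : ∀ z : ℂ, |z.im| ≤ θ → DifferentiableAt ℂ G z)
    (hC : ∀ z : ℂ, |z.im| ≤ θ → ‖G z‖ ≤ C * Real.exp (-α * z.re))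
    (hi : ∀ y : ℝ, |y| = θ →
      Integrable fun x : ℝ => (exp (x + y * I) / (μ - exp (x + y * I))) • G (x + y * I)) :
    (∫ x : ℝ, (exp (x + θ * I) / (μ - exp (x + θ * I))) • G (x + θ * I)) -
      (∫ x : ℝ, (exp (x + (-θ : ℝ) * I) / (μ - exp (x + (-θ : ℝ) * I))) • G (x + (-θ : ℝ) * I))
      = (2 * Real.pi * I) • G (Real.log μ) := by
  set p : ℂ := (Real.log μ : ℂ) with hp
  have hep : exp p = μ := by rw [hp, ← ofReal_exp, Real.exp_log hμ]
  have hpim : |p.im| ≤ θ := by rw [hp, ofReal_im, abs_zero]; exact h0.le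
  set D : ℂ → ℂ := fun z => μ - exp z with hD
  -- The subtracted multiple of `G p` removes the pole at `p`: its coefficient is `1` there, decays
  -- like `e^{-z}` to the right, and has no pole in the strip as `θ < π`. Its integral is known from
  -- `tendsto_log_sub_log`.
  set N : ℂ → E := fun z => exp z • (G z - ((1 + μ) / (1 + exp z)) • G p) with hN
  have hDp : D p = 0 := by simp [hD, hep]
  have hNp : N p = 0 := by
    have : (1 + (μ : ℂ)) ≠ 0 := by rw [← hep]; exact one_add_exp_ne_zero hπ hpim
    simp [hN, hep, div_self this]
  have hDd : ∀ z, DifferentiableAt ℂ D z := fun z => by fun_prop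
  have hNd : ∀ z : ℂ, |z.im| ≤ θ → DifferentiableAt ℂ N z := fun z hz => by
    have h1 := hG z hz
    have h2 := one_add_exp_ne_zero hπ hz
    have h3 : DifferentiableAt ℂ (fun z : ℂ => (1 + μ) / (1 + exp z)) z := by
      refine DifferentiableAt.div (by fun_prop) (by fun_prop) h2
    exact DifferentiableAt.smul (by fun_prop) (h1.sub (h3.smul_const _))
  -- A quotient of divided differences is `N / D` off `p` and extends it continuously through `p`;
  -- Cauchy–Goursat with one exceptional point then needs no removable-singularity argument.
  set Ψ : ℂ → E := fun z => (dslope D p z)⁻¹ • dslope N p z with hΨ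
  have hΨne : ∀ z, z ≠ p → Ψ z = (D z)⁻¹ • N z := by
    intro z hz
    have hzp := sub_ne_zero.2 hz
    simp only [hΨ, dslope_of_ne _ hz, slope_def_module, hDp, hNp, sub_zero, smul_eq_mul, smul_smul]
    congr 1
    field_simp
  have hD0 : ∀ z : ℂ, |z.im| ≤ θ → dslope D p z ≠ 0 := by
    intro z hz
    rcases eq_or_ne z p with rfl | h
    · have : HasDerivAt D (-exp p) p := (Complex.hasDerivAt_exp p).const_sub _
      rw [dslope_same, this.deriv]
      exact neg_ne_zero.2 (exp_ne_zero _)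
    · rw [dslope_of_ne _ h, slope_def_module, hDp, sub_zero]
      refine smul_ne_zero (inv_ne_zero (sub_ne_zero.2 h)) ?_
      exact sub_ne_zero.2 (exp_ne_ofReal hμ hπ hz h).symm
  have hΨc : ∀ z : ℂ, |z.im| ≤ θ → ContinuousAt Ψ z := by
    intro z hz
    rcases eq_or_ne z p with rfl | h
    · exact ((continuousAt_dslope_same.2 (hDd _)).inv₀ (hD0 _ hz)).smul
        (continuousAt_dslope_same.2 (hNd _ hz))
    · exact (((continuousAt_dslope_of_ne h).2 (hDd _).continuousAt).inv₀ (hD0 _ hz)).smul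
        ((continuousAt_dslope_of_ne h).2 (hNd _ hz).continuousAt)
  have hΨd : ∀ z : ℂ, |z.im| ≤ θ → z ≠ p → DifferentiableAt ℂ Ψ z := fun z hz h =>
    (((differentiableAt_dslope_of_ne h).2 (hDd z)).inv (hD0 z hz)).smul
      ((differentiableAt_dslope_of_ne h).2 (hNd z hz))
  have hC0 : 0 ≤ C := by
    have := (norm_nonneg _).trans (hC p hpim)
    exact nonneg_of_mul_nonneg_left this (Real.exp_pos _)
  have hrect : ∀ R : ℝ, 0 ≤ R →
      (∫ x in (-R)..R, Ψ (x + (-θ : ℝ) * I)) - (∫ x in (-R)..R, Ψ (x + θ * I)) +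
        I • (∫ y in (-θ)..θ, Ψ (R + y * I)) - I • (∫ y in (-θ)..θ, Ψ ((-R : ℝ) + y * I)) = 0 := by
    intro R hR
    have := integral_boundary_rect_eq_zero_of_differentiable_on_off_countable Ψ
      ⟨-R, -θ⟩ ⟨R, θ⟩ {p} (countable_singleton p) ?_ ?_
    · exact this
    · intro z hz
      refine (hΨc z ?_).continuousWithinAt
      have := (mem_reProdIm.1 hz).2
      rw [uIcc_of_le (by simp; linarith)] at this
      exact abs_le.2 this
    · intro z hz
      refine hΨd z ?_ hz.2
      have := (mem_reProdIm.1 hz.1).2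
      simp only [min_eq_left (show -θ ≤ θ by linarith), max_eq_right (show -θ ≤ θ by linarith)] at this
      exact abs_le.2 ⟨this.1.le, this.2.le⟩
  -- the vertical sides
  have hside : ∀ (σ : ℝ → ℝ) (b : ℝ → ℝ), Tendsto b atTop (𝓝 0) →
      (∀ᶠ R in atTop, ∀ y : ℝ, |y| ≤ θ → ‖Ψ (σ R + y * I)‖ ≤ b R) →
      Tendsto (fun R : ℝ => I • ∫ y in (-θ)..θ, Ψ (σ R + y * I)) atTop (𝓝 0) := by
    intro σ b hb hev
    have hlim : Tendsto (fun R => b R * (2 * θ)) atTop (𝓝 0) := by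
      simpa using hb.mul_const (2 * θ)
    refine squeeze_zero_norm' ?_ hlim
    filter_upwards [hev] with R hR
    rw [norm_smul, norm_I, one_mul]
    refine (intervalIntegral.norm_integral_le_of_norm_le_const (C := b R) fun y hy => ?_).trans ?_
    · rw [uIoc_of_le (by linarith)] at hy
      exact hR y (abs_le.2 ⟨hy.1.le, hy.2⟩)
    · rw [abs_of_nonneg (by linarith)]
      apply le_of_eq
      ring
  have hΨn : ∀ z : ℂ, |z.im| ≤ θ → z ≠ p → ∀ a b : ℝ, 0 < a → 0 < b → a ≤ ‖(μ : ℂ) - exp z‖ →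
      b ≤ ‖1 + exp z‖ → ‖Ψ z‖ ≤ a⁻¹ * (Real.exp z.re *
        (C * Real.exp (-α * z.re) + (1 + μ) / b * ‖G p‖)) := by
    intro z hz hne a b ha hb h1 h2
    rw [hΨne z hne, norm_smul, norm_inv]
    simp only [hD, hN]
    rw [norm_smul, norm_exp]
    gcongr
    refine (norm_sub_le _ _).trans ?_
    gcongr
    · exact hC z hz
    · rw [norm_smul, norm_div]
      gcongr
      rw [← ofReal_one, ← ofReal_add, norm_real, Real.norm_of_nonneg (by linarith)]
  have hre : ∀ x y : ℝ, ((x : ℂ) + y * I).re = x := fun x y => by simp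
  have him : ∀ x y : ℝ, ((x : ℂ) + y * I).im = y := fun x y => by simp
  -- For large `R` both denominators are at least `e^R / 2`, leaving decay of order `e^{-αR} +
  -- e^{-R}`.
  have hright : Tendsto (fun R : ℝ => I • ∫ y in (-θ)..θ, Ψ (R + y * I)) atTop (𝓝 0) := by
    refine hside (fun R => R) (fun R => 2 * (C * Real.exp (-(α * R)) +
      2 * (1 + μ) * ‖G p‖ * Real.exp (-R))) ?_ ?_
    · have t1 : Tendsto (fun R : ℝ => Real.exp (-(α * R))) atTop (𝓝 0) :=
        Real.tendsto_exp_neg_atTop_nhds_zero.comp (tendsto_id.const_mul_atTop hα0)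
      simpa using ((t1.const_mul C).add
        (Real.tendsto_exp_neg_atTop_nhds_zero.const_mul (2 * (1 + μ) * ‖G p‖))).const_mul 2
    · filter_upwards [Real.tendsto_exp_atTop.eventually_gt_atTop (2 * μ + 2),
        eventually_gt_atTop (Real.log μ)] with R hR hR' y hy
      have hne : (R : ℂ) + y * I ≠ p := fun h => by
        have := congrArg Complex.re h
        rw [hre, hp, ofReal_re] at this
        linarith
      have hn : ‖exp ((R : ℂ) + y * I)‖ = Real.exp R := by rw [norm_exp, hre]
      have h1 : Real.exp R / 2 ≤ ‖(μ : ℂ) - exp ((R : ℂ) + y * I)‖ := by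
        have := norm_sub_norm_le (exp ((R : ℂ) + y * I)) μ
        rw [norm_sub_rev, hn, norm_real, Real.norm_of_nonneg hμ.le] at this
        linarith
      have h2 : Real.exp R / 2 ≤ ‖1 + exp ((R : ℂ) + y * I)‖ := by
        have := norm_sub_norm_le (exp ((R : ℂ) + y * I)) (-1)
        rw [sub_neg_eq_add, add_comm (exp _), hn, norm_neg, norm_one] at this
        linarith
      refine (hΨn _ (by rwa [him]) hne _ _ (by positivity) (by positivity) h1 h2).trans
        (le_of_eq ?_)
      rw [hre, Real.exp_neg R, neg_mul]
      field_simp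
  -- Here the denominators stay away from `0`, and the factor `e^{-R}` beats the growth `e^{αR}` of
  -- `G` because `α < 1`.
  have hleft : Tendsto (fun R : ℝ => I • ∫ y in (-θ)..θ, Ψ ((-R : ℝ) + y * I)) atTop (𝓝 0) := by
    refine hside (fun R => -R) (fun R => 2 / μ * (C * Real.exp (-((1 - α) * R)) +
      2 * (1 + μ) * ‖G p‖ * Real.exp (-R))) ?_ ?_
    · have t1 : Tendsto (fun R : ℝ => Real.exp (-((1 - α) * R))) atTop (𝓝 0) :=
        Real.tendsto_exp_neg_atTop_nhds_zero.comp
          (tendsto_id.const_mul_atTop (by linarith : (0 : ℝ) < 1 - α))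
      simpa using ((t1.const_mul C).add
        (Real.tendsto_exp_neg_atTop_nhds_zero.const_mul (2 * (1 + μ) * ‖G p‖))).const_mul (2 / μ)
    · filter_upwards [Real.tendsto_exp_neg_atTop_nhds_zero.eventually_lt_const
          (show 0 < μ / 2 by positivity),
        Real.tendsto_exp_neg_atTop_nhds_zero.eventually_lt_const (show (0 : ℝ) < 1 / 2 by norm_num),
        eventually_gt_atTop (-Real.log μ)] with R hR hR1 hR' y hy
      have hne : ((-R : ℝ) : ℂ) + y * I ≠ p := fun h => by
        have := congrArg Complex.re h
        rw [hre, hp, ofReal_re] at this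
        linarith
      have hn : ‖exp (((-R : ℝ) : ℂ) + y * I)‖ = Real.exp (-R) := by rw [norm_exp, hre]
      have h1 : μ / 2 ≤ ‖(μ : ℂ) - exp (((-R : ℝ) : ℂ) + y * I)‖ := by
        have := norm_sub_norm_le (μ : ℂ) (exp (((-R : ℝ) : ℂ) + y * I))
        rw [hn, norm_real, Real.norm_of_nonneg hμ.le] at this
        linarith
      have h2 : 1 / 2 ≤ ‖1 + exp (((-R : ℝ) : ℂ) + y * I)‖ := by
        have := norm_sub_norm_le (1 : ℂ) (-exp (((-R : ℝ) : ℂ) + y * I))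
        rw [sub_neg_eq_add, norm_neg, hn, norm_one] at this
        linarith
      refine (hΨn _ (by rwa [him]) hne _ _ (by positivity) (by positivity) h1 h2).trans
        (le_of_eq ?_)
      rw [hre, show -((1 - α) * R) = -R + -α * -R by ring, Real.exp_add]
      field_simp
  -- the horizontal sides
  have hline : ∀ y : ℝ, |y| = θ → ∀ R : ℝ, ∫ x in (-R)..R, Ψ (x + y * I) =
      (∫ x in (-R)..R, (exp (x + y * I) / (μ - exp (x + y * I))) • G (x + y * I)) -
      (∫ x in (-R)..R, (1 + μ) * exp (x + y * I) /
        ((μ - exp (x + y * I)) * (1 + exp (x + y * I)))) • G p := by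
    intro y hy R
    have hne : ∀ x : ℝ, (x : ℂ) + y * I ≠ p := fun x h => by
      have := congrArg Complex.im h
      rw [him, hp, ofReal_im] at this
      rw [this, abs_zero] at hy
      linarith
    have n1 : ∀ x : ℝ, μ - exp (x + y * I) ≠ 0 := fun x =>
      sub_ne_zero.2 (exp_ne_ofReal hμ hπ (by rw [him, hy]) (hne x)).symm
    have n2 : ∀ x : ℝ, 1 + exp (x + y * I) ≠ 0 := fun x =>
      one_add_exp_ne_zero hπ (by rw [him, hy])
    rw [← intervalIntegral.integral_smul_const, ← intervalIntegral.integral_sub]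
    · congr 1 with x
      rw [hΨne _ (hne x)]
      simp only [hD, hN]
      rw [smul_smul, smul_sub, smul_smul]
      congr 2
      · rw [div_eq_inv_mul]
      · have := n1 x
        have := n2 x
        field_simp
    · exact (hi y hy).intervalIntegrable
    · refine Continuous.intervalIntegrable (Continuous.smul ?_ continuous_const) _ _
      exact Continuous.div (by fun_prop) (by fun_prop) fun x => mul_ne_zero (n1 x) (n2 x)
  have hsin : ∀ y : ℝ, |y| = θ → Real.sin y ≠ 0 := by
    intro y hy
    have hs := Real.sin_pos_of_pos_of_lt_pi h0 hπ
    rcases (abs_eq h0.le).1 hy with rfl | rfl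
    · exact hs.ne'
    · rw [Real.sin_neg]; exact (neg_neg_of_pos hs).ne
  have hlim : ∀ y : ℝ, |y| = θ → Tendsto (fun R : ℝ => ∫ x in (-R)..R, Ψ (x + y * I)) atTop
      (𝓝 ((∫ x : ℝ, (exp (x + y * I) / (μ - exp (x + y * I))) • G (x + y * I)) -
        (log (exp (y * I)) - log (-exp (y * I)) + log μ) • G p)) := by
    intro y hy
    simp only [hline y hy]
    exact (intervalIntegral_tendsto_integral (hi y hy) tendsto_neg_atTop_atBot tendsto_id).sub
      ((tendsto_log_sub_log hμ (hsin y hy)).smul_const _)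
  have a1 : |θ| = θ := abs_of_pos h0
  have a2 : |(-θ)| = θ := by rw [abs_neg, a1]
  have htot := (((hlim (-θ) a2).sub (hlim θ a1)).add hright).sub hleft
  have hzero := tendsto_nhds_unique htot ((tendsto_const_nhds (x := (0 : E))).congr' (by
    filter_upwards [eventually_ge_atTop 0] with R hR using (hrect R hR).symm))
  -- The terms `log μ` cancel between the two edges; only the jumps survive.
  obtain ⟨l1, l2⟩ := log_exp_sub_log_neg_exp h0 hπ
  rw [l1, l2, add_zero, sub_zero] at hzero
  rw [← sub_eq_zero, ← neg_eq_zero, ← hzero]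
  module

end Strip

/-! ### The inverse Laplace transform of the resolvent at `μ ^ α`. -/

section Contour

open Complex

/-- The half-opening angle of the integration contour. -/
noncomputable def contourAngle (α : ℝ) : ℝ := Real.pi / (1 + α)

section Angle

variable {α : ℝ} (hα0 : 0 < α) (hα1 : α < 1)
include hα0

/-- The angle `θ = π / (1 + α)` is chosen for two properties: `π/2 < θ < π`, so that `e^{tw}` decays
on the rays, and `αθ < π/2`, so that `w^α` stays in the right half-plane. -/
theorem contourAngle_pos : 0 < contourAngle α := by
  have := Real.pi_pos
  unfold contourAngle
  positivity

theorem contourAngle_lt_pi : contourAngle α < Real.pi := by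
  have := Real.pi_pos
  rw [contourAngle, div_lt_iff₀ (by linarith)]
  nlinarith

include hα1

theorem pi_div_two_lt_contourAngle : Real.pi / 2 < contourAngle α :=
  div_lt_div_of_pos_left Real.pi_pos (by linarith) (by linarith)

theorem mul_contourAngle_lt : α * contourAngle α < Real.pi / 2 := by
  have := Real.pi_pos
  rw [contourAngle, ← mul_div_assoc, div_lt_div_iff₀ (by linarith) two_pos]
  nlinarith

theorem cos_contourAngle_neg : Real.cos (contourAngle α) < 0 := by
  have := Real.pi_pos
  exact Real.cos_neg_of_pi_div_two_lt_of_lt (pi_div_two_lt_contourAngle hα0 hα1)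
    (by linarith [contourAngle_lt_pi hα0])

theorem cos_mul_contourAngle_pos : 0 < Real.cos (α * contourAngle α) := by
  have := mul_pos hα0 (contourAngle_pos hα0)
  exact Real.cos_pos_of_mem_Ioo ⟨by linarith [Real.pi_pos], mul_contourAngle_lt hα0 hα1⟩

end Angle

theorem integrable_exp_neg_mul_exp {d β : ℝ} (hd : 0 < d) (hβ : 0 < β) :
    Integrable fun x : ℝ => Real.exp (-d * Real.exp x) * Real.exp (β * x) := by
  have hc : Continuous fun x : ℝ => Real.exp (-d * Real.exp x) * Real.exp (β * x) := by fun_prop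
  rw [← integrableOn_univ, ← Iic_union_Ioi (a := (0 : ℝ))]
  refine IntegrableOn.union ?_ ?_
  · refine Integrable.mono' (integrableOn_exp_mul_Iic hβ 0) hc.aestronglyMeasurable
      (Eventually.of_forall fun x => ?_)
    rw [Real.norm_of_nonneg (by positivity)]
    refine mul_le_of_le_one_left (Real.exp_pos _).le (Real.exp_le_one_iff.2 ?_)
    have := mul_pos hd (Real.exp_pos x)
    linarith
  · refine integrable_of_isBigO_exp_neg one_pos hc.continuousOn (Asymptotics.IsBigO.of_bound 1 ?_)
    -- From `e^x ≥ x²/2`, beyond this threshold `d e^x ≥ (β + 1) x`, so the product is at most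
    -- `e^{-x}`.
    filter_upwards [eventually_ge_atTop (2 * (β + 1) / d), eventually_ge_atTop 0] with x hx hx0
    rw [Real.norm_of_nonneg (by positivity), Real.norm_of_nonneg (by positivity), one_mul,
      ← Real.exp_add, Real.exp_le_exp]
    have h1 := Real.quadratic_le_exp_of_nonneg hx0
    rw [div_le_iff₀ hd] at hx
    nlinarith [mul_le_mul_of_nonneg_left h1 hd.le, mul_le_mul_of_nonneg_right hx hx0,
      mul_nonneg hd.le hx0]

/-- Scaling by `t` is translation by `log t` in the logarithmic variable. With `β = 1 - α` this is
the source of the power `t^{α-1}`. -/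
theorem exp_mul_exp_eq_translate {d β t : ℝ} (ht : 0 < t) (x : ℝ) :
    Real.exp (-d * (t * Real.exp x)) * Real.exp (β * x) =
      t ^ (-β) * (Real.exp (-d * Real.exp (x + Real.log t)) *
        Real.exp (β * (x + Real.log t))) := by
  rw [Real.rpow_def_of_pos ht, Real.exp_add x, Real.exp_log ht, mul_add, Real.exp_add (β * x)]
  have : Real.exp (Real.log t * -β) * Real.exp (β * Real.log t) = 1 := by
    rw [← Real.exp_add]
    simp [mul_comm]
  rw [mul_comm (Real.exp x) t]
  linear_combination -(Real.exp (-d * (t * Real.exp x)) * Real.exp (β * x)) * this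

theorem integrable_exp_neg_mul_mul_exp {d β t : ℝ} (hd : 0 < d) (hβ : 0 < β) (ht : 0 < t) :
    Integrable fun x : ℝ => Real.exp (-d * (t * Real.exp x)) * Real.exp (β * x) := by
  simp only [exp_mul_exp_eq_translate ht]
  exact ((integrable_exp_neg_mul_exp hd hβ).comp_add_right (Real.log t)).const_mul _

theorem integral_exp_neg_mul_mul_exp {d β t : ℝ} (ht : 0 < t) :
    ∫ x : ℝ, Real.exp (-d * (t * Real.exp x)) * Real.exp (β * x) =
      t ^ (-β) * ∫ x : ℝ, Real.exp (-d * Real.exp x) * Real.exp (β * x) := by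
  simp only [exp_mul_exp_eq_translate ht]
  rw [integral_const_mul, integral_add_right_eq_self
    (fun x : ℝ => Real.exp (-d * Real.exp x) * Real.exp (β * x))]

variable {H : Type*} [NormedAddCommGroup H] [InnerProductSpace ℂ H]

/-- The resolvent at `w ^ α`, in the logarithmic variable `w = e ^ z`. -/
noncomputable def resolExp (A : H →ₗ.[ℂ] H) (α : ℝ) (z : ℂ) : H →L[ℂ] H := resol A (exp (α * z))

/-- The integrand of the inversion integral, in the logarithmic variable. -/
noncomputable def contourKer (A : H →ₗ.[ℂ] H) (α t : ℝ) (z : ℂ) : H →L[ℂ] H :=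
  (exp (t * exp z) * exp z) • resolExp A α z

/-- The integral of `contourKer` over the ray with angle `y`. -/
noncomputable def rayIntegral (A : H →ₗ.[ℂ] H) (α y t : ℝ) : H →L[ℂ] H :=
  ∫ x : ℝ, contourKer A α t (x + y * I)

/-- The inverse Laplace transform of `μ ↦ (μ ^ α - A)⁻¹`. -/
noncomputable def invLaplace (A : H →ₗ.[ℂ] H) (α t : ℝ) : H →L[ℂ] H :=
  (2 * Real.pi * I)⁻¹ •
    (rayIntegral A α (contourAngle α) t - rayIntegral A α (-contourAngle α) t)

variable [CompleteSpace H] {A : H →ₗ.[ℂ] H} (hA : IsMDissipative A) {α : ℝ} (hα0 : 0 < α)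
  (hα1 : α < 1)

-- The real part is `e^{α Re z} cos(α Im z)`, and cosine decreases on `[0, αθ]`.
include hα0 hα1 in
theorem le_re_exp {z : ℂ} (hz : |z.im| ≤ contourAngle α) :
    Real.exp (α * z.re) * Real.cos (α * contourAngle α) ≤ (exp (α * z)).re := by
  rw [exp_re, re_ofReal_mul, im_ofReal_mul]
  gcongr
  rw [← Real.cos_abs (α * z.im), abs_mul, abs_of_pos hα0]
  refine Real.cos_le_cos_of_nonneg_of_le_pi (by positivity) ?_ (by gcongr)
  linarith [mul_contourAngle_lt hα0 hα1, Real.pi_pos]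

include hα0 hα1 in
theorem re_exp_pos {z : ℂ} (hz : |z.im| ≤ contourAngle α) : 0 < (exp (α * z)).re :=
  (mul_pos (Real.exp_pos _) (cos_mul_contourAngle_pos hα0 hα1)).trans_le (le_re_exp hα0 hα1 hz)

-- On the rays `Re w < 0 < μ`, so the time integral of `e^{(w-μ)t}` converges to `1 / (μ - w)`.
include hα0 hα1 in
theorem integral_exp_smul_contourKer {y : ℝ} (hy : |y| = contourAngle α) {μ : ℝ} (hμ : 0 < μ)
    (x : ℝ) : ∫ t in Ioi 0, Real.exp (-μ * t) • contourKer A α t (x + y * I) =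
      (exp (x + y * I) / (μ - exp (x + y * I))) • resolExp A α (x + y * I) := by
  have hd := cos_contourAngle_neg hα0 hα1
  have hre : (exp (x + y * I) - μ).re < 0 := by
    rw [sub_re, exp_re, ofReal_re]
    have hcos : Real.cos y = Real.cos (contourAngle α) := by rw [← Real.cos_abs, hy]
    have := mul_neg_of_pos_of_neg (Real.exp_pos x) hd
    simp only [add_re, ofReal_re, mul_re, I_re, mul_zero, ofReal_im, I_im, mul_one, sub_self,
      add_zero, add_im, mul_im, zero_add, hcos]
    linarith
  have h : ∀ t : ℝ, Real.exp (-μ * t) • contourKer A α t (x + y * I) =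
      exp ((exp (x + y * I) - μ) * t) • (exp (x + y * I) • resolExp A α (x + y * I)) := by
    intro t
    rw [contourKer, ← coe_smul, smul_smul, smul_smul, ofReal_exp, ← mul_assoc, ← exp_add]
    congr 3
    push_cast
    ring
  simp only [h]
  rw [integral_smul_const, integral_exp_mul_complex_Ioi hre, ofReal_zero, mul_zero, exp_zero,
    smul_smul]
  congr 1
  have hne : exp (x + y * I) - μ ≠ 0 := fun h0 => by simp [h0] at hre
  have hne' : (μ : ℂ) - exp (x + y * I) ≠ 0 := by rwa [← neg_ne_zero, neg_sub]
  field_simp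
  ring

include hA hα0 hα1

theorem norm_resolExp_le {z : ℂ} (hz : |z.im| ≤ contourAngle α) :
    ‖resolExp A α z‖ ≤ (Real.cos (α * contourAngle α))⁻¹ * Real.exp (-α * z.re) := by
  have hc := cos_mul_contourAngle_pos hα0 hα1
  refine (hA.norm_resol_le (re_exp_pos hα0 hα1 hz)).trans ?_
  rw [neg_mul, Real.exp_neg, ← mul_inv, mul_comm (Real.cos _)]
  exact inv_anti₀ (by positivity) (le_re_exp hα0 hα1 hz)

theorem differentiableAt_resolExp {z : ℂ} (hz : |z.im| ≤ contourAngle α) :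
    DifferentiableAt ℂ (resolExp A α) z :=
  (hA.differentiableAt_resol (re_exp_pos hα0 hα1 hz)).comp z (by fun_prop)

theorem continuous_resolExp_line {y : ℝ} (hy : |y| = contourAngle α) :
    Continuous fun x : ℝ => resolExp A α (x + y * I) := by
  refine continuous_iff_continuousAt.2 fun x => ?_
  have hz : |((x : ℂ) + y * I).im| ≤ contourAngle α := by simp [hy]
  exact ContinuousAt.comp (f := fun x : ℝ => (x : ℂ) + y * I)
    (differentiableAt_resolExp hA hα0 hα1 hz).continuousAt (by fun_prop)

theorem continuous_contourKer {y : ℝ} (hy : |y| = contourAngle α) :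
    Continuous fun q : ℝ × ℝ => contourKer A α q.1 (q.2 + y * I) := by
  unfold contourKer
  have h : Continuous fun q : ℝ × ℝ =>
      exp (q.1 * exp (q.2 + y * I)) * exp (q.2 + y * I) := by fun_prop
  refine h.smul ?_
  exact (continuous_resolExp_line hA hα0 hα1 hy).comp continuous_snd

theorem norm_contourKer_le {y : ℝ} (hy : |y| = contourAngle α) (t x : ℝ) :
    ‖contourKer A α t (x + y * I)‖ ≤ (Real.cos (α * contourAngle α))⁻¹ *
      (Real.exp (-(-Real.cos (contourAngle α)) * (t * Real.exp x)) *
        Real.exp ((1 - α) * x)) := by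
  have h := norm_resolExp_le hA hα0 hα1 (z := x + y * I) (by simp [hy])
  have hre : ((x : ℂ) + y * I).re = x := by simp
  have him : ((x : ℂ) + y * I).im = y := by simp
  have hcos : Real.cos y = Real.cos (contourAngle α) := by rw [← Real.cos_abs, hy]
  rw [hre] at h
  rw [contourKer, norm_smul, norm_mul, norm_exp, norm_exp, re_ofReal_mul, exp_re, hre, him, hcos]
  refine (mul_le_mul_of_nonneg_left h (by positivity)).trans (le_of_eq ?_)
  rw [show (1 - α) * x = x + -α * x by ring, Real.exp_add x,
    show t * (Real.exp x * Real.cos (contourAngle α)) =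
      -(-Real.cos (contourAngle α)) * (t * Real.exp x) by ring]
  ring

theorem integrable_contourKer {y : ℝ} (hy : |y| = contourAngle α) {t : ℝ} (ht : 0 < t) :
    Integrable fun x : ℝ => contourKer A α t (x + y * I) := by
  have hd := cos_contourAngle_neg hα0 hα1
  refine Integrable.mono' ((integrable_exp_neg_mul_mul_exp (neg_pos.2 hd)
    (show 0 < 1 - α by linarith) ht).const_mul _) ?_
    (Eventually.of_forall (norm_contourKer_le hA hα0 hα1 hy t))
  exact Continuous.aestronglyMeasurable
    ((continuous_contourKer hA hα0 hα1 hy).comp (continuous_const.prodMk continuous_id))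

theorem exists_integral_norm_contourKer_le : ∃ C : ℝ, 0 ≤ C ∧ ∀ y : ℝ, |y| = contourAngle α →
    ∀ t : ℝ, 0 < t → ∫ x : ℝ, ‖contourKer A α t (x + y * I)‖ ≤ C * t ^ (α - 1) := by
  have hc := cos_mul_contourAngle_pos hα0 hα1
  refine ⟨(Real.cos (α * contourAngle α))⁻¹ * ∫ x : ℝ,
    Real.exp (-(-Real.cos (contourAngle α)) * Real.exp x) * Real.exp ((1 - α) * x), ?_,
    fun y hy t ht => ?_⟩
  · exact mul_nonneg (by positivity) (integral_nonneg fun x => by positivity)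
  · have hd := cos_contourAngle_neg hα0 hα1
    refine (integral_mono (integrable_contourKer hA hα0 hα1 hy ht).norm
      ((integrable_exp_neg_mul_mul_exp (neg_pos.2 hd) (show 0 < 1 - α by linarith) ht).const_mul _)
      (norm_contourKer_le hA hα0 hα1 hy t)).trans (le_of_eq ?_)
    rw [integral_const_mul, integral_exp_neg_mul_mul_exp ht, neg_sub]
    ring

theorem exists_norm_invLaplace_le :
    ∃ C : ℝ, 0 ≤ C ∧ ∀ t : ℝ, 0 < t → ‖invLaplace A α t‖ ≤ C * t ^ (α - 1) := by
  obtain ⟨C, hC0, hC⟩ := exists_integral_norm_contourKer_le hA hα0 hα1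
  have a1 : |contourAngle α| = contourAngle α := abs_of_pos (contourAngle_pos hα0)
  have a2 : |(-contourAngle α)| = contourAngle α := by rw [abs_neg, a1]
  refine ⟨‖(2 * Real.pi * I : ℂ)⁻¹‖ * (C + C), by positivity, fun t ht => ?_⟩
  rw [invLaplace, norm_smul, mul_assoc ‖_‖, add_mul]
  gcongr
  refine (norm_sub_le _ _).trans (add_le_add ?_ ?_)
  · exact (norm_integral_le_integral_norm _).trans (hC _ a1 t ht)
  · exact (norm_integral_le_integral_norm _).trans (hC _ a2 t ht)

theorem continuousOn_rayIntegral {y : ℝ} (hy : |y| = contourAngle α) :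
    ContinuousOn (rayIntegral A α y) (Ioi 0) := by
  intro t ht
  refine ContinuousAt.continuousWithinAt ?_
  have hd := cos_contourAngle_neg hα0 hα1
  have ht2 : t / 2 < t := half_lt_self ht
  refine continuousAt_of_dominated (bound := fun x : ℝ => (Real.cos (α * contourAngle α))⁻¹ *
      (Real.exp (-(-Real.cos (contourAngle α)) * (t / 2 * Real.exp x)) *
        Real.exp ((1 - α) * x))) ?_ ?_ ?_ ?_
  · exact Eventually.of_forall fun s => Continuous.aestronglyMeasurable
      ((continuous_contourKer hA hα0 hα1 hy).comp (continuous_const.prodMk continuous_id))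
  · filter_upwards [lt_mem_nhds ht2] with s hs
    refine Eventually.of_forall fun x => (norm_contourKer_le hA hα0 hα1 hy s x).trans ?_
    have hc := cos_mul_contourAngle_pos hα0 hα1
    gcongr ?_ * (Real.exp ?_ * ?_)
    have := mul_le_mul_of_nonneg_right hs.le (Real.exp_pos x).le
    nlinarith
  · exact (integrable_exp_neg_mul_mul_exp (neg_pos.2 hd) (show 0 < 1 - α by linarith)
      (half_pos ht)).const_mul _
  · exact Eventually.of_forall fun x => Continuous.continuousAt
      ((continuous_contourKer hA hα0 hα1 hy).comp (continuous_id.prodMk continuous_const))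

theorem continuousOn_invLaplace : ContinuousOn (invLaplace A α) (Ioi 0) := by
  have a1 : |contourAngle α| = contourAngle α := abs_of_pos (contourAngle_pos hα0)
  have a2 : |(-contourAngle α)| = contourAngle α := by rw [abs_neg, a1]
  exact ContinuousOn.const_smul ((continuousOn_rayIntegral hA hα0 hα1 a1).sub
    (continuousOn_rayIntegral hA hα0 hα1 a2)) (2 * Real.pi * I : ℂ)⁻¹

theorem commute_rayIntegral {y : ℝ} (hy : |y| = contourAngle α) {t : ℝ} (ht : 0 < t)
    {B : H →L[ℂ] H} (hB : ∀ z : ℂ, 0 < z.re → Commute (resol A z) B) :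
    Commute (rayIntegral A α y t) B := by
  have hi := integrable_contourKer hA hα0 hα1 hy ht
  have h1 := (ContinuousLinearMap.mul ℂ (H →L[ℂ] H) B).integral_comp_comm hi
  have h2 := ((ContinuousLinearMap.mul ℂ (H →L[ℂ] H)).flip B).integral_comp_comm hi
  simp only [ContinuousLinearMap.flip_apply, ContinuousLinearMap.mul_apply'] at h1 h2
  change rayIntegral A α y t * B = B * rayIntegral A α y t
  rw [rayIntegral, ← h1, ← h2]
  congr 1 with x : 1
  refine Commute.eq (Commute.smul_left (hB _ (re_exp_pos hα0 hα1 ?_)) _)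
  simp [hy]

theorem commute_invLaplace {t : ℝ} (ht : 0 < t) :
    Commute (invLaplace A α t) (resol A 1) := by
  have a1 : |contourAngle α| = contourAngle α := abs_of_pos (contourAngle_pos hα0)
  have a2 : |(-contourAngle α)| = contourAngle α := by rw [abs_neg, a1]
  have hB : ∀ z : ℂ, 0 < z.re → Commute (resol A z) (resol A 1) := fun z hz =>
    hA.resol_comm hz (by simp)
  exact ((commute_rayIntegral hA hα0 hα1 a1 ht hB).sub_left
    (commute_rayIntegral hA hα0 hα1 a2 ht hB)).smul_left _

/-- Joint integrability for Fubini: integrating norms along the ray first gives `C t^{α-1}`, which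
is integrable against `e^{-μt}` as `α > 0`. -/
theorem integrable_exp_smul_contourKer {y : ℝ} (hy : |y| = contourAngle α) {μ : ℝ} (hμ : 0 < μ) :
    Integrable (fun q : ℝ × ℝ => Real.exp (-μ * q.1) • contourKer A α q.1 (q.2 + y * I))
      ((volume.restrict (Ioi 0)).prod volume) := by
  obtain ⟨C, hC0, hC⟩ := exists_integral_norm_contourKer_le hA hα0 hα1
  have hm : Continuous (fun q : ℝ × ℝ =>
      Real.exp (-μ * q.1) • contourKer A α q.1 (q.2 + y * I)) :=
    Continuous.smul (f := fun q : ℝ × ℝ => Real.exp (-μ * q.1)) (by fun_prop)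
      (continuous_contourKer hA hα0 hα1 hy)
  rw [integrable_prod_iff hm.aestronglyMeasurable]
  constructor
  · exact (ae_restrict_iff' measurableSet_Ioi).2 (Eventually.of_forall fun t ht =>
      (integrable_contourKer hA hα0 hα1 hy ht).smul (Real.exp (-μ * t)))
  · have hb : IntegrableOn (fun t : ℝ => C * (t ^ (α - 1) * Real.exp (-μ * t ^ (1 : ℝ)))) (Ioi 0) :=
      (integrableOn_rpow_mul_exp_neg_mul_rpow (by linarith) one_pos hμ).const_mul C
    refine Integrable.mono' hb ?_ ?_
    · exact (hm.norm.aestronglyMeasurable (μ := (volume.restrict (Ioi 0)).prod volume)).integral_prod_right'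
    · refine (ae_restrict_iff' measurableSet_Ioi).2 (Eventually.of_forall fun t ht => ?_)
      simp only [norm_smul]
      rw [integral_const_mul, Real.norm_of_nonneg (mul_nonneg (norm_nonneg _)
        (integral_nonneg fun _ => norm_nonneg _)), Real.norm_of_nonneg (Real.exp_pos _).le,
        Real.rpow_one]
      calc Real.exp (-μ * t) * ∫ x : ℝ, ‖contourKer A α t (x + y * I)‖
          ≤ Real.exp (-μ * t) * (C * t ^ (α - 1)) := by
            gcongr
            exact hC y hy t ht
        _ = C * (t ^ (α - 1) * Real.exp (-μ * t)) := by ring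

/-- A by-product of Fubini, without estimating the denominator; this is the edge integrability
required by `strip_integral_sub`. -/
theorem integrable_laplace_ray {y : ℝ} (hy : |y| = contourAngle α) {μ : ℝ} (hμ : 0 < μ) :
    Integrable fun x : ℝ =>
      (exp (x + y * I) / (μ - exp (x + y * I))) • resolExp A α (x + y * I) := by
  simp only [← integral_exp_smul_contourKer (A := A) hα0 hα1 hy hμ]
  exact (integrable_exp_smul_contourKer hA hα0 hα1 hy hμ).integral_prod_right

theorem integrableOn_exp_smul_rayIntegral {y : ℝ} (hy : |y| = contourAngle α) {μ : ℝ}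
    (hμ : 0 < μ) : IntegrableOn (fun t => Real.exp (-μ * t) • rayIntegral A α y t) (Ioi 0) := by
  have := (integrable_exp_smul_contourKer hA hα0 hα1 hy hμ).integral_prod_left
  simp only [integral_smul] at this
  exact this

theorem laplace_rayIntegral {y : ℝ} (hy : |y| = contourAngle α) {μ : ℝ} (hμ : 0 < μ) :
    ∫ t in Ioi 0, Real.exp (-μ * t) • rayIntegral A α y t = ∫ x : ℝ,
      (exp (x + y * I) / (μ - exp (x + y * I))) • resolExp A α (x + y * I) := by
  have := integral_integral_swap (f := fun t x : ℝ =>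
    Real.exp (-μ * t) • contourKer A α t (x + y * I))
    (integrable_exp_smul_contourKer hA hα0 hα1 hy hμ)
  simp only [integral_exp_smul_contourKer (A := A) hα0 hα1 hy hμ, integral_smul] at this
  exact this

theorem integrableOn_exp_smul_invLaplace {μ : ℝ} (hμ : 0 < μ) :
    IntegrableOn (fun t => Real.exp (-μ * t) • invLaplace A α t) (Ioi 0) := by
  have a1 : |contourAngle α| = contourAngle α := abs_of_pos (contourAngle_pos hα0)
  have a2 : |(-contourAngle α)| = contourAngle α := by rw [abs_neg, a1]
  have h := (((integrableOn_exp_smul_rayIntegral hA hα0 hα1 a1 hμ).sub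
    (integrableOn_exp_smul_rayIntegral hA hα0 hα1 a2 hμ)).smul (2 * Real.pi * I : ℂ)⁻¹)
  refine h.congr (Eventually.of_forall fun t => ?_)
  simp only [Pi.smul_apply, Pi.sub_apply]
  rw [invLaplace, smul_comm, smul_sub, smul_sub, smul_sub]

/-- The Laplace transform of `invLaplace`. -/
theorem laplace_invLaplace {μ : ℝ} (hμ : 0 < μ) :
    ∫ t in Ioi 0, Real.exp (-μ * t) • invLaplace A α t = resol A ((μ ^ α : ℝ) : ℂ) := by
  have a1 : |contourAngle α| = contourAngle α := abs_of_pos (contourAngle_pos hα0)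
  have a2 : |(-contourAngle α)| = contourAngle α := by rw [abs_neg, a1]
  have h : ∀ t : ℝ, Real.exp (-μ * t) • invLaplace A α t = (2 * Real.pi * I : ℂ)⁻¹ •
      (Real.exp (-μ * t) • rayIntegral A α (contourAngle α) t -
        Real.exp (-μ * t) • rayIntegral A α (-contourAngle α) t) := fun t => by
    rw [invLaplace, smul_comm, smul_sub (Real.exp _)]
  simp only [h]
  rw [integral_smul, integral_sub (integrableOn_exp_smul_rayIntegral hA hα0 hα1 a1 hμ)
    (integrableOn_exp_smul_rayIntegral hA hα0 hα1 a2 hμ),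
    laplace_rayIntegral hA hα0 hα1 a1 hμ, laplace_rayIntegral hA hα0 hα1 a2 hμ,
    strip_integral_sub hμ (contourAngle_pos hα0) (contourAngle_lt_pi hα0) hα0 hα1
      (fun z hz => differentiableAt_resolExp hA hα0 hα1 hz)
      (fun z hz => norm_resolExp_le hA hα0 hα1 hz)
      (fun y hy => integrable_laplace_ray hA hα0 hα1 hy hμ), smul_smul,
    inv_mul_cancel₀ two_pi_I_ne_zero, one_smul, resolExp, Real.rpow_def_of_pos hμ]
  congr 1
  push_cast
  rw [mul_comm]

end Contour

/-! ### Power kernels and convolutions with a singular function. -/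

section Kernels

theorem gKer_of_pos {β t : ℝ} (ht : 0 < t) : gKer β t = t ^ (β - 1) / Real.Gamma β := if_pos ht

theorem gKer_nonneg {β : ℝ} (hβ : 0 < β) (t : ℝ) : 0 ≤ gKer β t := by
  unfold gKer
  have := Real.Gamma_pos_of_pos hβ
  split_ifs <;> positivity

theorem continuousOn_gKer (β : ℝ) : ContinuousOn (gKer β) (Ioi 0) := by
  refine ContinuousOn.congr (f := fun t => t ^ (β - 1) / Real.Gamma β) ?_ fun t ht => gKer_of_pos ht
  exact (continuousOn_id.rpow_const fun t ht => Or.inl (ne_of_gt ht)).div_const _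

theorem integrableOn_rpow_Ioc {β : ℝ} (hβ : 0 < β) (T : ℝ) :
    IntegrableOn (fun t : ℝ => t ^ (β - 1)) (Ioc 0 T) := by
  rcases le_or_gt 0 T with h | h
  · rw [← intervalIntegrable_iff_integrableOn_Ioc_of_le h]
    exact intervalIntegral.intervalIntegrable_rpow' (by linarith)
  · simp [Ioc_eq_empty_of_le h.le]

theorem integrableOn_exp_mul_rpow {β μ : ℝ} (hβ : 0 < β) (hμ : 0 < μ) :
    IntegrableOn (fun t : ℝ => Real.exp (-μ * t) * t ^ (β - 1)) (Ioi 0) := by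
  have := integrableOn_rpow_mul_exp_neg_mul_rpow (s := β - 1) (by linarith) one_pos hμ
  simpa only [Real.rpow_one, mul_comm] using this

theorem laplace_gKer {β μ : ℝ} (hβ : 0 < β) (hμ : 0 < μ) :
    ∫ t in Ioi 0, Real.exp (-μ * t) * gKer β t = μ ^ (-β) := by
  have h := Real.integral_rpow_mul_exp_neg_mul_Ioi hβ hμ
  have hG := (Real.Gamma_pos_of_pos hβ).ne'
  calc ∫ t in Ioi 0, Real.exp (-μ * t) * gKer β t
      = ∫ t in Ioi 0, (Real.Gamma β)⁻¹ * (t ^ (β - 1) * Real.exp (-(μ * t))) := by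
        refine setIntegral_congr_fun measurableSet_Ioi fun t ht => ?_
        simp only [gKer_of_pos (mem_Ioi.1 ht), neg_mul]
        ring
    _ = μ ^ (-β) := by
        rw [integral_const_mul, h, one_div, Real.inv_rpow hμ.le, Real.rpow_neg hμ.le]
        field_simp

/-- `p` is continuous on `(0, ∞)` and `O(t ^ (β - 1))` there. -/
structure HasPowBound {E : Type*} [NormedAddCommGroup E] (β : ℝ) (p : ℝ → E) : Prop where
  continuousOn : ContinuousOn p (Ioi 0)
  bound : ∃ C : ℝ, 0 ≤ C ∧ ∀ t : ℝ, 0 < t → ‖p t‖ ≤ C * t ^ (β - 1)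

theorem hasPowBound_gKer {β : ℝ} (hβ : 0 < β) : HasPowBound β (gKer β) := by
  have hG := Real.Gamma_pos_of_pos hβ
  refine ⟨continuousOn_gKer β, (Real.Gamma β)⁻¹, by positivity, fun t ht => ?_⟩
  rw [Real.norm_of_nonneg (gKer_nonneg hβ t), gKer_of_pos ht, div_eq_inv_mul]

variable {E : Type*} [NormedAddCommGroup E] {β : ℝ} {p : ℝ → E}

theorem HasPowBound.integrableOn (h : HasPowBound β p) (hβ : 0 < β) (T : ℝ) :
    IntegrableOn p (Ioc 0 T) := by
  obtain ⟨C, -, hC⟩ := h.bound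
  refine Integrable.mono' ((integrableOn_rpow_Ioc hβ T).const_mul C)
    ((h.continuousOn.mono Ioc_subset_Ioi_self).aestronglyMeasurable measurableSet_Ioc) ?_
  exact (ae_restrict_iff' measurableSet_Ioc).2 (Eventually.of_forall fun t ht => hC t ht.1)

theorem IntegrableOn.continuousOn_integral [NormedSpace ℝ E]
    (h : ∀ T, IntegrableOn p (Ioc 0 T)) :
    ContinuousOn (fun t => ∫ s in (0 : ℝ)..t, p s) (Ici 0) := by
  intro t ht
  have ht0 : (0 : ℝ) ≤ t := ht
  have hi : IntervalIntegrable p volume 0 (t + 1) :=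
    (intervalIntegrable_iff_integrableOn_Ioc_of_le (by linarith)).2 (h _)
  have hc := intervalIntegral.continuousOn_primitive_interval' hi left_mem_uIcc
  rw [uIcc_of_le (by linarith)] at hc
  refine (hc t ⟨ht0, by linarith⟩).mono_of_mem_nhdsWithin ?_
  rw [← Ici_inter_Iic]
  exact inter_mem_nhdsWithin _ (Iic_mem_nhds (by linarith))

theorem HasPowBound.integrableOn_exp_smul [NormedSpace ℝ E] (h : HasPowBound β p) (hβ : 0 < β)
    {μ : ℝ} (hμ : 0 < μ) : IntegrableOn (fun t => Real.exp (-μ * t) • p t) (Ioi 0) := by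
  obtain ⟨C, -, hC⟩ := h.bound
  refine Integrable.mono' ((integrableOn_exp_mul_rpow hβ hμ).const_mul C) ?_ ?_
  · refine ContinuousOn.aestronglyMeasurable ?_ measurableSet_Ioi
    exact ContinuousOn.smul (Continuous.continuousOn (by fun_prop)) h.continuousOn
  · refine (ae_restrict_iff' measurableSet_Ioi).2 (Eventually.of_forall fun t ht => ?_)
    rw [norm_smul, Real.norm_of_nonneg (Real.exp_pos _).le]
    calc Real.exp (-μ * t) * ‖p t‖ ≤ Real.exp (-μ * t) * (C * t ^ (β - 1)) := by
          gcongr; exact hC t ht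
      _ = C * (Real.exp (-μ * t) * t ^ (β - 1)) := by ring

theorem intervalIntegrable_beta {α : ℝ} (hα0 : 0 < α) (hα1 : α < 1) :
    IntervalIntegrable (fun x : ℝ => (1 - x) ^ (-α) * x ^ (α - 1)) volume 0 1 := by
  have h := (Complex.betaIntegral_convergent (u := α) (v := (1 - α : ℝ)) (by simpa using hα0)
    (by simpa using hα1)).norm
  rw [intervalIntegrable_iff_integrableOn_Ioo_of_le zero_le_one] at h ⊢
  refine h.congr_fun (fun x hx => ?_) measurableSet_Ioo
  have h1 : (0 : ℝ) < 1 - x := by linarith [hx.2]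
  simp only [norm_mul]
  have e1 : ((x : ℂ)) ^ ((α : ℂ) - 1) = ((x ^ (α - 1) : ℝ) : ℂ) := by
    rw [Complex.ofReal_cpow hx.1.le]; push_cast; rfl
  have e2 : (1 - (x : ℂ)) ^ (((1 - α : ℝ) : ℂ) - 1) = (((1 - x) ^ (-α) : ℝ) : ℂ) := by
    rw [Complex.ofReal_cpow h1.le]; push_cast; congr 1; ring
  rw [e1, e2, Complex.norm_real, Complex.norm_real, Real.norm_of_nonneg (by have := hx.1; positivity),
    Real.norm_of_nonneg (by positivity), mul_comm]

/-- The exponents add up to `-1`, so `s = tx` turns the Beta integral over `(0, t)` into one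
independent of `t`. The uniform bound on the solution operator rests on this. -/
theorem rpow_mul_rpow_scale {α t x : ℝ} (ht : 0 < t) (hx : x ∈ Ioo (0 : ℝ) 1) :
    (t - t * x) ^ (-α) * (t * x) ^ (α - 1) = t⁻¹ * ((1 - x) ^ (-α) * x ^ (α - 1)) := by
  have h1 : (0 : ℝ) < 1 - x := by linarith [hx.2]
  rw [show t - t * x = t * (1 - x) by ring, Real.mul_rpow ht.le h1.le, Real.mul_rpow ht.le hx.1.le]
  have : t ^ (-α) * t ^ (α - 1) = t⁻¹ := by
    rw [← Real.rpow_add ht, ← Real.rpow_neg_one]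
    congr 1; ring
  rw [← this]
  ring

theorem intervalIntegrable_beta_scale {α : ℝ} (hα0 : 0 < α) (hα1 : α < 1) {t : ℝ} (ht : 0 < t) :
    IntervalIntegrable (fun s : ℝ => (t - s) ^ (-α) * s ^ (α - 1)) volume 0 t := by
  rw [← IntervalIntegrable.comp_mul_left_iff (c := t) ht.ne']
  simp only [zero_div, div_self ht.ne']
  refine (((intervalIntegrable_beta hα0 hα1).const_mul t⁻¹).congr_ae ?_)
  rw [uIoc_of_le zero_le_one, Filter.EventuallyEq, ← restrict_Ioo_eq_restrict_Ioc,
    ae_restrict_iff' measurableSet_Ioo]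
  exact Eventually.of_forall fun x hx => (rpow_mul_rpow_scale ht hx).symm

theorem integral_beta_scale {α t : ℝ} (ht : 0 < t) :
    ∫ s in (0 : ℝ)..t, (t - s) ^ (-α) * s ^ (α - 1) =
      ∫ x in (0 : ℝ)..1, (1 - x) ^ (-α) * x ^ (α - 1) := by
  have h := intervalIntegral.mul_integral_comp_mul_left
    (f := fun s : ℝ => (t - s) ^ (-α) * s ^ (α - 1)) (a := 0) (b := 1) t
  rw [mul_zero, mul_one] at h
  rw [← h, ← intervalIntegral.integral_const_mul]
  simp only [intervalIntegral.integral_of_le zero_le_one, integral_Ioc_eq_integral_Ioo]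
  refine setIntegral_congr_fun measurableSet_Ioo fun x hx => ?_
  simp only [rpow_mul_rpow_scale ht hx, mul_inv_cancel_left₀ ht.ne']

variable {α : ℝ} (hα0 : 0 < α) (hα1 : α < 1)

include hα1 in
theorem HasPowBound.norm_gKer_smul_le (h : HasPowBound α p) : ∃ M : ℝ, 0 ≤ M ∧
    ∀ t s : ℝ, s ∈ Ioo 0 t →
      ‖gKer (1 - α) (t - s)‖ * ‖p s‖ ≤ M * ((t - s) ^ (-α) * s ^ (α - 1)) := by
  obtain ⟨C, hC0, hC⟩ := h.bound
  have hG := Real.Gamma_pos_of_pos (show 0 < 1 - α by linarith)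
  refine ⟨(Real.Gamma (1 - α))⁻¹ * C, by positivity, fun t s hs => ?_⟩
  have hts : 0 < t - s := sub_pos.2 hs.2
  rw [Real.norm_of_nonneg (gKer_nonneg (by linarith) _), gKer_of_pos hts,
    show (1 - α - 1) = -α by ring]
  calc (t - s) ^ (-α) / Real.Gamma (1 - α) * ‖p s‖
      ≤ (t - s) ^ (-α) / Real.Gamma (1 - α) * (C * s ^ (α - 1)) := by
        gcongr; exact hC s hs.1
    _ = _ := by ring

variable [NormedSpace ℝ E]

/-- Over the fixed interval `(0, 1)` the integrand has a majorant independent of `t`, so continuity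
in `t` follows by dominated convergence. -/
theorem conv_eq_scale {k : ℝ → ℝ} {t : ℝ} :
    conv k p t = ∫ x in (0 : ℝ)..1, t • (k (t - t * x) • p (t * x)) := by
  have h := intervalIntegral.smul_integral_comp_mul_left
    (f := fun s : ℝ => k (t - s) • p s) (a := 0) (b := 1) t
  rw [mul_zero, mul_one] at h
  rw [conv, ← h, intervalIntegral.integral_smul]

include hα0 hα1

theorem HasPowBound.intervalIntegrable_gKer_smul (h : HasPowBound α p) {t : ℝ} (ht : 0 < t) :
    IntervalIntegrable (fun s => gKer (1 - α) (t - s) • p s) volume 0 t := by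
  obtain ⟨M, -, hM⟩ := h.norm_gKer_smul_le hα1
  have hb := intervalIntegrable_beta_scale hα0 hα1 ht
  rw [intervalIntegrable_iff_integrableOn_Ioo_of_le ht.le] at hb ⊢
  refine Integrable.mono' (hb.const_mul M) ?_ ?_
  · refine ContinuousOn.aestronglyMeasurable ?_ measurableSet_Ioo
    refine ContinuousOn.smul ?_ (h.continuousOn.mono Ioo_subset_Ioi_self)
    exact (continuousOn_gKer _).comp (by fun_prop) fun s hs => mem_Ioi.2 (sub_pos.2 hs.2)
  · refine (ae_restrict_iff' measurableSet_Ioo).2 (Eventually.of_forall fun s hs => ?_)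
    rw [norm_smul]
    exact hM t s hs

/-- The bound is uniform in `t`; it controls the solution operator and supplies the boundedness
alternative of `bconv_assoc`. -/
theorem HasPowBound.exists_integral_norm_le (h : HasPowBound α p) :
    ∃ M : ℝ, 0 ≤ M ∧ ∀ t : ℝ, 0 < t →
      ∫ s in (0 : ℝ)..t, ‖gKer (1 - α) (t - s)‖ * ‖p s‖ ≤ M := by
  obtain ⟨M, hM0, hM⟩ := h.norm_gKer_smul_le hα1
  refine ⟨M * ∫ x in (0 : ℝ)..1, (1 - x) ^ (-α) * x ^ (α - 1), mul_nonneg hM0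
    (intervalIntegral.integral_nonneg zero_le_one fun x hx => ?_), fun t ht => ?_⟩
  · have h1 : 0 ≤ 1 - x := by linarith [hx.2]
    have h2 := hx.1
    positivity
  · rw [← integral_beta_scale ht, ← intervalIntegral.integral_const_mul]
    have hi := (h.intervalIntegrable_gKer_smul hα0 hα1 ht).norm
    simp only [norm_smul] at hi
    refine intervalIntegral.integral_mono_on_of_le_Ioo ht.le hi
      ((intervalIntegrable_beta_scale hα0 hα1 ht).const_mul M) fun s hs => hM t s hs

theorem HasPowBound.exists_norm_conv_le (h : HasPowBound α p) :
    ∃ M : ℝ, 0 ≤ M ∧ ∀ t : ℝ, 0 < t → ‖conv (gKer (1 - α)) p t‖ ≤ M := by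
  obtain ⟨M, hM0, hM⟩ := h.exists_integral_norm_le hα0 hα1
  refine ⟨M, hM0, fun t ht => le_trans ?_ (hM t ht)⟩
  refine (intervalIntegral.norm_integral_le_integral_norm ht.le).trans (le_of_eq ?_)
  simp only [norm_smul]

theorem HasPowBound.continuousOn_conv (h : HasPowBound α p) :
    ContinuousOn (conv (gKer (1 - α)) p) (Ioi 0) := by
  obtain ⟨M, -, hM⟩ := h.norm_gKer_smul_le hα1
  intro t ht
  refine ContinuousAt.continuousWithinAt ?_
  have e : conv (gKer (1 - α)) p =
      fun t => ∫ x in Ioo (0 : ℝ) 1, t • (gKer (1 - α) (t - t * x) • p (t * x)) := by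
    funext t
    rw [conv_eq_scale, intervalIntegral.integral_of_le zero_le_one, integral_Ioc_eq_integral_Ioo]
  have hb := intervalIntegrable_beta hα0 hα1
  rw [intervalIntegrable_iff_integrableOn_Ioo_of_le zero_le_one] at hb
  have hpos : ∀ s : ℝ, 0 < s → ∀ x ∈ Ioo (0 : ℝ) 1, s * x ∈ Ioi (0 : ℝ) ∧
      s - s * x ∈ Ioi (0 : ℝ) := fun s hs x hx =>
    ⟨mul_pos hs hx.1, by rw [mem_Ioi]; nlinarith [hx.2]⟩
  rw [e]
  refine continuousAt_of_dominated (bound := fun x => M * ((1 - x) ^ (-α) * x ^ (α - 1)))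
    ?_ ?_ (hb.const_mul M) ?_
  · filter_upwards [lt_mem_nhds (mem_Ioi.1 ht)] with s hs
    refine ContinuousOn.aestronglyMeasurable ?_ measurableSet_Ioo
    refine ContinuousOn.const_smul (ContinuousOn.smul ?_ ?_) s
    · exact (continuousOn_gKer _).comp (by fun_prop) fun x hx => (hpos s hs x hx).2
    · exact h.continuousOn.comp (by fun_prop) fun x hx => (hpos s hs x hx).1
  · filter_upwards [lt_mem_nhds (mem_Ioi.1 ht)] with s hs
    refine (ae_restrict_iff' measurableSet_Ioo).2 (Eventually.of_forall fun x hx => ?_)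
    rw [norm_smul, norm_smul, Real.norm_of_nonneg hs.le]
    have hsx : s * x ∈ Ioo 0 s := ⟨mul_pos hs hx.1, by nlinarith [hx.2]⟩
    refine (mul_le_mul_of_nonneg_left (hM s (s * x) hsx) hs.le).trans (le_of_eq ?_)
    rw [rpow_mul_rpow_scale hs hx]
    field_simp
  · refine (ae_restrict_iff' measurableSet_Ioo).2 (Eventually.of_forall fun x hx => ?_)
    obtain ⟨h1, h2⟩ := hpos t ht x hx
    refine ContinuousAt.smul continuousAt_id (ContinuousAt.smul ?_ ?_)
    · exact ContinuousAt.comp (f := fun s : ℝ => s - s * x)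
        ((continuousOn_gKer _).continuousAt (Ioi_mem_nhds h2)) (by fun_prop)
    · exact ContinuousAt.comp (f := fun s : ℝ => s * x)
        (h.continuousOn.continuousAt (Ioi_mem_nhds h1)) (by fun_prop)

/-- By scaling the convolution is constant in `t`; comparing Laplace transforms at `μ = 1` finds the
constant without evaluating the Beta integral. -/
theorem conv_gKer_gKer {t : ℝ} (ht : 0 < t) : conv (gKer (1 - α)) (gKer α) t = 1 := by
  have hscale : ∀ s : ℝ, 0 < s → conv (gKer (1 - α)) (gKer α) s = conv (gKer (1 - α)) (gKer α) 1 := by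
    have key : ∀ s : ℝ, 0 < s → conv (gKer (1 - α)) (gKer α) s =
        (Real.Gamma (1 - α))⁻¹ * (Real.Gamma α)⁻¹ *
          ∫ x in (0 : ℝ)..1, (1 - x) ^ (-α) * x ^ (α - 1) := by
      intro s hs
      rw [← integral_beta_scale hs, ← intervalIntegral.integral_const_mul, conv]
      simp only [intervalIntegral.integral_of_le hs.le, integral_Ioc_eq_integral_Ioo]
      refine setIntegral_congr_fun measurableSet_Ioo fun x hx => ?_
      simp only [smul_eq_mul]
      rw [gKer_of_pos (sub_pos.2 hx.2), gKer_of_pos hx.1, show (1 - α - 1) = -α by ring]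
      ring
    intro s hs
    rw [key s hs, key 1 one_pos]
  have h1α : 0 < 1 - α := by linarith
  have hL := laplace_conv (μ := 1)
    ((hasPowBound_gKer h1α).integrableOn_exp_smul h1α one_pos)
    ((hasPowBound_gKer hα0).integrableOn_exp_smul hα0 one_pos)
  simp only [smul_eq_mul] at hL
  rw [laplace_gKer h1α one_pos, laplace_gKer hα0 one_pos, Real.one_rpow, Real.one_rpow, one_mul,
    setIntegral_congr_fun measurableSet_Ioi
      (fun s hs => by rw [hscale s hs] : EqOn _ (fun s => Real.exp (-1 * s) *
        conv (gKer (1 - α)) (gKer α) 1) (Ioi 0)), integral_mul_const] at hL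
  have : ∫ s in Ioi (0 : ℝ), Real.exp (-1 * s) = 1 := by
    simpa using integral_exp_neg_Ioi_zero
  rw [this, one_mul] at hL
  rw [hscale t ht, hL]

end Kernels

/-! ### The solution operator of the untempered equation. -/

section SolutionOperator

variable {H : Type*} [NormedAddCommGroup H] [InnerProductSpace ℂ H]

/-- The solution operator of the untempered equation. -/
noncomputable def solOp (A : H →ₗ.[ℂ] H) (α t : ℝ) : H →L[ℂ] H :=
  -- The convolution would vanish at `t = 0`, where the identity is needed.
  open Classical in if 0 < t then conv (gKer (1 - α)) (invLaplace A α) t else 1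

variable [CompleteSpace H] {A : H →ₗ.[ℂ] H} (hA : IsMDissipative A) {α : ℝ} (hα0 : 0 < α)
  (hα1 : α < 1)

omit [CompleteSpace H] in
theorem solOp_of_pos {t : ℝ} (ht : 0 < t) :
    solOp A α t = conv (gKer (1 - α)) (invLaplace A α) t := if_pos ht

omit [CompleteSpace H] in
theorem solOp_zero : solOp A α 0 = 1 := if_neg (lt_irrefl 0)

include hA hα0 hα1

theorem hasPowBound_invLaplace : HasPowBound α (invLaplace A α) :=
  ⟨continuousOn_invLaplace hA hα0 hα1, exists_norm_invLaplace_le hA hα0 hα1⟩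

theorem hasPowBound_invLaplace_apply (x : H) : HasPowBound α (fun t => invLaplace A α t x) := by
  obtain ⟨C, hC0, hC⟩ := exists_norm_invLaplace_le hA hα0 hα1
  refine ⟨(continuousOn_invLaplace hA hα0 hα1).clm_apply continuousOn_const, C * ‖x‖,
    by positivity, fun t ht => ?_⟩
  calc ‖invLaplace A α t x‖ ≤ C * t ^ (α - 1) * ‖x‖ := (invLaplace A α t).le_of_opNorm_le (hC t ht) x
    _ = _ := by ring

theorem solOp_apply {t : ℝ} (ht : 0 < t) (x : H) :
    solOp A α t x = conv (gKer (1 - α)) (fun s => invLaplace A α s x) t := by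
  have hi := (hasPowBound_invLaplace hA hα0 hα1).intervalIntegrable_gKer_smul hα0 hα1 ht
  rw [solOp_of_pos ht, conv, conv, intervalIntegral.integral_of_le ht.le,
    intervalIntegral.integral_of_le ht.le]
  rw [intervalIntegrable_iff_integrableOn_Ioc_of_le ht.le] at hi
  exact ContinuousLinearMap.integral_apply hi x

theorem exists_norm_solOp_le : ∃ M : ℝ, 0 < M ∧ ∀ t : ℝ, ‖solOp A α t‖ ≤ M := by
  obtain ⟨M, hM0, hM⟩ := (hasPowBound_invLaplace hA hα0 hα1).exists_norm_conv_le hα0 hα1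
  -- The added `1` covers `t ≤ 0`, where the operator is the identity, and makes the constant
  -- positive.
  refine ⟨M + 1, by positivity, fun t => ?_⟩
  by_cases ht : 0 < t
  · rw [solOp_of_pos ht]
    linarith [hM t ht]
  · rw [solOp, if_neg ht]
    exact ContinuousLinearMap.norm_id_le.trans (by linarith)

theorem laplace_invLaplace_apply (x : H) {μ : ℝ} (hμ : 0 < μ) :
    ∫ t in Ioi 0, Real.exp (-μ * t) • invLaplace A α t x = resol A ((μ ^ α : ℝ) : ℂ) x := by
  rw [← laplace_invLaplace hA hα0 hα1 hμ,
    ContinuousLinearMap.integral_apply (integrableOn_exp_smul_invLaplace hA hα0 hα1 hμ)]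
  rfl

/-- With `R = (μ^α - A)⁻¹`, the difference of the two sides has Laplace transform `μ⁻¹ (μ^α R x - R
A x - x)`, which is `0` because `R` is a left inverse. -/
theorem solOp_apply_eq {x : H} (hx : x ∈ A.domain) {t : ℝ} (ht : 0 ≤ t) :
    solOp A α t x = x + ∫ s in (0 : ℝ)..t, invLaplace A α s (opVal A x) := by
  rcases ht.eq_or_lt with rfl | ht
  · simp [solOp_zero]
  set y := opVal A x
  have h1α : 0 < 1 - α := by linarith
  have hpx := hasPowBound_invLaplace_apply hA hα0 hα1 x
  have hpy := hasPowBound_invLaplace_apply hA hα0 hα1 y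
  -- The integral is written as convolution with `g₁`, so that `laplace_conv` covers both terms.
  set f : ℝ → H := fun t => conv (gKer (1 - α)) (fun s => invLaplace A α s x) t -
    conv (gKer 1) (fun s => invLaplace A α s y) t - x with hf
  have hone : ∀ {w : ℝ → H} {t : ℝ}, 0 < t → conv (gKer 1) w t = ∫ s in (0 : ℝ)..t, w s := by
    intro w t ht
    rw [← conv_one, ← bconv_lsmul, ← bconv_lsmul]
    exact bconv_congr _ ht.le (fun s hs => by simp [gKer_of_pos hs.1]) fun _ _ => rfl
  have hfc : ContinuousOn f (Ioi 0) := by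
    refine ((hpx.continuousOn_conv hα0 hα1).sub ?_).sub continuousOn_const
    exact ((IntegrableOn.continuousOn_integral (hpy.integrableOn hα0)).mono
      Ioi_subset_Ici_self).congr fun s hs => hone hs
  have hexpi : ∀ μ : ℝ, 0 < μ → IntegrableOn (fun t => Real.exp (-μ * t) • x) (Ioi 0) :=
    fun μ hμ => (integrableOn_exp_mul_Ioi (by linarith) 0).smul_const x
  have hi1 : ∀ μ : ℝ, 0 < μ → IntegrableOn (fun t => Real.exp (-μ * t) •
      conv (gKer (1 - α)) (fun s => invLaplace A α s x) t) (Ioi 0) := fun μ hμ =>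
    integrableOn_laplace_conv ((hasPowBound_gKer h1α).integrableOn_exp_smul h1α hμ)
      (hpx.integrableOn_exp_smul hα0 hμ)
  have hi2 : ∀ μ : ℝ, 0 < μ → IntegrableOn (fun t => Real.exp (-μ * t) •
      conv (gKer 1) (fun s => invLaplace A α s y) t) (Ioi 0) := fun μ hμ =>
    integrableOn_laplace_conv ((hasPowBound_gKer one_pos).integrableOn_exp_smul one_pos hμ)
      (hpy.integrableOn_exp_smul hα0 hμ)
  have hL : ∀ μ : ℝ, 0 < μ → ∫ t in Ioi 0, Real.exp (-μ * t) • f t = 0 := by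
    intro μ hμ
    simp only [hf, smul_sub]
    have hi12 : IntegrableOn (fun t =>
        Real.exp (-μ * t) • conv (gKer (1 - α)) (fun s => invLaplace A α s x) t -
        Real.exp (-μ * t) • conv (gKer 1) (fun s => invLaplace A α s y) t) (Ioi 0) :=
      (hi1 μ hμ).sub (hi2 μ hμ)
    rw [integral_sub hi12 (hexpi μ hμ), integral_sub (hi1 μ hμ) (hi2 μ hμ),
      laplace_conv ((hasPowBound_gKer h1α).integrableOn_exp_smul h1α hμ)
        (hpx.integrableOn_exp_smul hα0 hμ),
      laplace_conv ((hasPowBound_gKer one_pos).integrableOn_exp_smul one_pos hμ)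
        (hpy.integrableOn_exp_smul hα0 hμ),
      laplace_gKer h1α hμ, laplace_gKer one_pos hμ, laplace_invLaplace_apply hA hα0 hα1 x hμ,
      laplace_invLaplace_apply hA hα0 hα1 y hμ, integral_smul_const,
      integral_exp_mul_Ioi (by linarith)]
    have hpos : 0 < (((μ ^ α : ℝ) : ℂ)).re := by
      rw [Complex.ofReal_re]; positivity
    have hres := hA.resol_sub_opVal hpos hx
    rw [Complex.coe_smul] at hres
    have e1 : μ ^ (-(1 - α)) = μ⁻¹ * μ ^ α := by
      rw [neg_sub, sub_eq_neg_add, Real.rpow_add hμ, Real.rpow_neg_one]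
    have e2 : -Real.exp (-μ * 0) / -μ = μ⁻¹ := by simp
    rw [e1, Real.rpow_neg_one, e2, mul_smul, ← smul_sub, ← smul_sub]
    rw [hres, sub_self, smul_zero]
  have hz := eq_zero_of_laplace_eq_zero hfc ?_ (fun n => hL _ (by positivity)) t ht
  · rw [hf, sub_eq_zero, sub_eq_iff_eq_add, hone ht, ← solOp_apply hA hα0 hα1 ht] at hz
    exact hz
  · have := ((hi1 1 one_pos).sub (hi2 1 one_pos)).sub (hexpi 1 one_pos)
    refine this.congr (Eventually.of_forall fun s => ?_)
    simp only [hf, smul_sub, Pi.sub_apply, neg_mul, one_mul]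

/-- On the domain, continuity up to `0` follows from `solOp_apply_eq`; density and the uniform bound
extend it to all of `H`. -/
theorem continuousOn_solOp_apply (x : H) : ContinuousOn (fun t => solOp A α t x) (Ici 0) := by
  obtain ⟨M, hM0, hM⟩ := exists_norm_solOp_le hA hα0 hα1
  refine continuousOn_of_uniform_approx_of_continuousOn fun u hu => ?_
  obtain ⟨ε, hε, hεu⟩ := Metric.mem_uniformity_dist.1 hu
  obtain ⟨y, hy, hxy⟩ := Metric.mem_closure_iff.1 (hA.dense_domain x) (ε / M) (by positivity)
  refine ⟨fun t => solOp A α t y, ?_, fun t _ => hεu ?_⟩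
  · refine ContinuousOn.congr ?_ fun t ht => solOp_apply_eq hA hα0 hα1 hy ht
    exact continuousOn_const.add (IntegrableOn.continuousOn_integral
      ((hasPowBound_invLaplace_apply hA hα0 hα1 _).integrableOn hα0))
  · rw [dist_eq_norm, ← map_sub]
    rw [dist_eq_norm, lt_div_iff₀ hM0] at hxy
    refine ((solOp A α t).le_of_opNorm_le (hM t) _).trans_lt ?_
    rwa [mul_comm]

/-- Commuting with one resolvent gives both invariance of the domain and commutation with `A`,
without using closedness of `A`. -/
theorem commute_solOp (t : ℝ) : Commute (solOp A α t) (resol A 1) := by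
  by_cases ht : 0 < t
  · have hi := (hasPowBound_invLaplace hA hα0 hα1).intervalIntegrable_gKer_smul hα0 hα1 ht
    have h1 := (ContinuousLinearMap.mul ℂ (H →L[ℂ] H) (resol A 1)).intervalIntegral_comp_comm hi
    have h2 := ((ContinuousLinearMap.mul ℂ (H →L[ℂ] H)).flip
      (resol A 1)).intervalIntegral_comp_comm hi
    simp only [ContinuousLinearMap.flip_apply, ContinuousLinearMap.mul_apply'] at h1 h2
    change solOp A α t * resol A 1 = resol A 1 * solOp A α t
    rw [solOp_of_pos ht, conv, ← h1, ← h2]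
    refine intervalIntegral.integral_congr_ae (Eventually.of_forall fun s hs => ?_)
    rw [uIoc_of_le ht.le] at hs
    exact ((commute_invLaplace hA hα0 hα1 hs.1).smul_left _).eq
  · rw [solOp, if_neg ht]
    exact Commute.one_left _

theorem solOp_mem_domain (t : ℝ) {x : H} (hx : x ∈ A.domain) : solOp A α t x ∈ A.domain :=
  (hA.mem_domain_of_commute (commute_solOp hA hα0 hα1 t) hx).1

theorem opVal_solOp (t : ℝ) {x : H} (hx : x ∈ A.domain) :
    opVal A (solOp A α t x) = solOp A α t (opVal A x) :=
  (hA.mem_domain_of_commute (commute_solOp hA hα0 hα1 t) hx).2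

/-- As `g_α * g_{1-α} = 1`, associativity gives `1 * P(Ax) = g_α * (g_{1-α} * P(Ax)) = g_α * S(Ax)`.
-/
theorem solOp_resolvent_eq {x : H} (hx : x ∈ A.domain) {t : ℝ} (ht : 0 ≤ t) :
    solOp A α t x = x + conv (gKer α) (fun s => solOp A α s (opVal A x)) t := by
  rcases ht.eq_or_lt with rfl | ht
  · simp [solOp_zero, conv]
  rw [solOp_apply_eq hA hα0 hα1 hx ht.le]
  congr 1
  have h1α : 0 < 1 - α := by linarith
  have hpy := hasPowBound_invLaplace_apply hA hα0 hα1 (opVal A x)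
  obtain ⟨M, -, hM⟩ := hpy.exists_integral_norm_le hα0 hα1
  have hL : ∀ (x y : ℝ) (z : H), ContinuousLinearMap.lsmul ℝ ℝ (ContinuousLinearMap.lsmul ℝ ℝ x y) z
      = ContinuousLinearMap.lsmul ℝ ℝ x (ContinuousLinearMap.lsmul ℝ ℝ y z) :=
    fun x y z => smul_assoc x y z
  have h := bconv_assoc _ _ _ _ hL ht ((hasPowBound_gKer hα0).integrableOn hα0 t)
    ((hasPowBound_gKer h1α).integrableOn h1α t) (hpy.integrableOn hα0 t)
    (Or.inr ⟨M, fun s hs => hM s hs.1⟩)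
  have hone : ∀ s : ℝ, 0 < s → conv (gKer α) (gKer (1 - α)) s = 1 := fun s hs => by
    have := conv_gKer_gKer (α := 1 - α) h1α (by linarith) hs
    rwa [sub_sub_cancel] at this
  rw [← conv_one, ← bconv_lsmul]
  refine (bconv_congr _ ht.le (fun s hs => (hone s hs.1).symm) fun _ _ => rfl).trans (h.trans ?_)
  exact bconv_congr _ ht.le (fun _ _ => rfl) fun s hs => (solOp_apply hA hα0 hα1 hs.1 _).symm

end SolutionOperator

/-! ### Continuous functions, primitives, and the tempered kernel. -/

section Auxiliary

open ContinuousLinearMap (lsmul)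

variable {E F G : Type*} [NormedAddCommGroup E] [NormedSpace ℝ E] [NormedAddCommGroup F]
  [NormedSpace ℝ F] [NormedAddCommGroup G] [NormedSpace ℝ G]

theorem bconv_flip (L : E →L[ℝ] F →L[ℝ] G) (f : ℝ → E) (g : ℝ → F) (t : ℝ) :
    bconv L.flip g f t = bconv L f g t := by
  have h := intervalIntegral.integral_comp_sub_left (fun s => L (f (t - s)) (g s)) t
    (a := 0) (b := t)
  simp only [sub_sub_cancel, sub_self, sub_zero] at h
  rw [bconv, bconv, ← h]
  rfl

theorem IntegrableOn.intervalIntegrable_sub_left {V : Type*} [NormedAddCommGroup V] {k : ℝ → V} {t : ℝ} (ht : 0 ≤ t)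
    (hk : IntegrableOn k (Ioc 0 t)) : IntervalIntegrable (fun s => k (t - s)) volume 0 t := by
  have h := ((intervalIntegrable_iff_integrableOn_Ioc_of_le ht).2 hk).comp_sub_left t
  simp only [sub_zero, sub_self] at h
  exact h.symm

theorem intervalIntegrable_conv {k : ℝ → ℝ} {u : ℝ → E} {t : ℝ} (ht : 0 ≤ t)
    (hk : IntegrableOn k (Ioc 0 t)) (hu : ContinuousOn u (Ici 0)) :
    IntervalIntegrable (fun s => k (t - s) • u s) volume 0 t := by
  refine (IntegrableOn.intervalIntegrable_sub_left ht hk).smul_continuousOn (hu.mono ?_)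
  rw [uIcc_of_le ht]
  exact Icc_subset_Ici_self

theorem intervalIntegrable_of_continuousOn_Ici {V : Type*} [NormedAddCommGroup V] {u : ℝ → V} (hu : ContinuousOn u (Ici 0)) {t : ℝ}
    (ht : 0 ≤ t) : IntervalIntegrable u volume 0 t := by
  refine (hu.mono ?_).intervalIntegrable
  rw [uIcc_of_le ht]
  exact Icc_subset_Ici_self

theorem integrableOn_of_continuousOn_Ici {V : Type*} [NormedAddCommGroup V] {u : ℝ → V} (hu : ContinuousOn u (Ici 0)) (t : ℝ) :
    IntegrableOn u (Ioc 0 t) := by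
  rcases le_or_gt 0 t with ht | ht
  · exact (intervalIntegrable_iff_integrableOn_Ioc_of_le ht).1
      (intervalIntegrable_of_continuousOn_Ici hu ht)
  · simp [Ioc_eq_empty_of_le ht.le]

/-- Provides the boundedness alternative of `bconv_assoc` when the last factor is continuous. -/
theorem exists_integral_norm_mul_le {k : ℝ → ℝ} {u : ℝ → E} {t : ℝ}
    (hk : IntegrableOn k (Ioc 0 t)) (hu : ContinuousOn u (Ici 0)) :
    ∃ M : ℝ, ∀ s ∈ Ioo 0 t, ∫ r in (0 : ℝ)..s, ‖k (s - r)‖ * ‖u r‖ ≤ M := by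
  obtain ⟨C, hC⟩ := isCompact_Icc.exists_bound_of_continuousOn
    (hu.mono (Icc_subset_Ici_self : Icc 0 t ⊆ Ici 0))
  refine ⟨(∫ r in (0 : ℝ)..t, ‖k r‖) * C, fun s hs => ?_⟩
  have hks : IntegrableOn k (Ioc 0 s) := hk.mono_set (Ioc_subset_Ioc_right hs.2.le)
  have hks' := (IntegrableOn.intervalIntegrable_sub_left hs.1.le hks).norm
  have hi := (intervalIntegrable_conv hs.1.le hks hu).norm
  simp only [norm_smul] at hi
  have hC0 : 0 ≤ C := (norm_nonneg _).trans (hC 0 ⟨le_rfl, by linarith [hs.1, hs.2]⟩)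
  calc ∫ r in (0 : ℝ)..s, ‖k (s - r)‖ * ‖u r‖
      ≤ ∫ r in (0 : ℝ)..s, ‖k (s - r)‖ * C := by
        refine intervalIntegral.integral_mono_on hs.1.le hi (hks'.mul_const C) fun r hr => ?_
        exact mul_le_mul_of_nonneg_left (hC r ⟨hr.1, hr.2.trans hs.2.le⟩) (norm_nonneg _)
    _ = (∫ r in (0 : ℝ)..s, ‖k r‖) * C := by
        rw [intervalIntegral.integral_mul_const]
        congr 1
        have := intervalIntegral.integral_comp_sub_left (fun r => ‖k r‖) s (a := 0) (b := s)
        rwa [sub_self, sub_zero] at this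
    _ ≤ (∫ r in (0 : ℝ)..t, ‖k r‖) * C := by
        refine mul_le_mul_of_nonneg_right ?_ hC0
        refine intervalIntegral.integral_mono_interval le_rfl hs.1.le hs.2.le
          (Eventually.of_forall fun _ => norm_nonneg _) ?_
        exact ((intervalIntegrable_iff_integrableOn_Ioc_of_le (hs.1.trans hs.2).le).2 hk).norm

theorem hasDerivAt_integral_of_continuousOn_Ioi [CompleteSpace E] {p : ℝ → E}
    (hp : ContinuousOn p (Ioi 0)) {t : ℝ} (ht : 0 < t) (hi : IntegrableOn p (Ioc 0 t)) :
    HasDerivAt (fun s => ∫ r in (0 : ℝ)..s, p r) (p t) t :=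
  intervalIntegral.integral_hasDerivAt_right
    ((intervalIntegrable_iff_integrableOn_Ioc_of_le ht.le).2 hi)
    (hp.stronglyMeasurableAtFilter isOpen_Ioi t ht) (hp.continuousAt (Ioi_mem_nhds ht))

theorem eq_zero_of_integral_eq_zero [CompleteSpace E] {p : ℝ → E} (hp : ContinuousOn p (Ici 0))
    (h : ∀ t : ℝ, 0 < t → ∫ s in (0 : ℝ)..t, p s = 0) {t : ℝ} (ht : 0 < t) : p t = 0 := by
  have h1 := hasDerivAt_integral_of_continuousOn_Ioi (hp.mono Ioi_subset_Ici_self) ht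
    (integrableOn_of_continuousOn_Ici hp t)
  have h2 : HasDerivAt (fun s => ∫ r in (0 : ℝ)..s, p r) 0 t := by
    refine (hasDerivAt_const t (0 : E)).congr_of_eventuallyEq ?_
    filter_upwards [lt_mem_nhds ht] with s hs using h s hs
  exact h1.unique h2

theorem contDiffOn_integral [CompleteSpace E] {p : ℝ → E} (hp : ContinuousOn p (Ici 0)) :
    ContDiffOn ℝ 1 (fun t => ∫ s in (0 : ℝ)..t, p s) (Ici 0) := by
  -- Extending `p` by `p 0` to negative times makes the primitive `C¹` on the whole line, which
  -- avoids one-sided derivatives at `0`.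
  have hq : Continuous fun t => p (max t 0) := by
    rw [← continuousOn_univ]
    exact hp.comp (by fun_prop) fun t _ => le_max_right t 0
  have hd : ∀ t, HasDerivAt (fun t => ∫ s in (0 : ℝ)..t, p (max s 0)) (p (max t 0)) t := fun t =>
    intervalIntegral.integral_hasDerivAt_right (hq.intervalIntegrable _ _)
      (hq.stronglyMeasurableAtFilter _ _) hq.continuousAt
  have hC : ContDiff ℝ 1 fun t => ∫ s in (0 : ℝ)..t, p (max s 0) := by
    rw [contDiff_one_iff_deriv]
    refine ⟨fun t => (hd t).differentiableAt, ?_⟩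
    rwa [show deriv (fun t => ∫ s in (0 : ℝ)..t, p (max s 0)) = fun t => p (max t 0) from
      funext fun t => (hd t).deriv]
  refine hC.contDiffOn.congr fun t ht => ?_
  refine intervalIntegral.integral_congr fun s hs => ?_
  rw [uIcc_of_le ht] at hs
  simp only [max_eq_left hs.1]

theorem continuousOn_smul_exp {p : ℝ → E} {s : Set ℝ} (hp : ContinuousOn p s) (c : ℝ) :
    ContinuousOn (fun t => Real.exp (c * t) • p t) s :=
  ContinuousOn.smul (f := fun t => Real.exp (c * t)) (Continuous.continuousOn (by fun_prop)) hp

theorem hasDerivAt_exp_mul (c t : ℝ) :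
    HasDerivAt (fun s => Real.exp (c * s)) (c * Real.exp (c * t)) t := by
  simpa [mul_comm] using ((hasDerivAt_id t).const_mul c).exp

theorem temperedKer_eq {α η t : ℝ} (ht : 0 < t) :
    temperedKer α η t = Real.exp (-η * t) * gKer (1 - α) t := by
  rw [temperedKer, gKer_of_pos ht, show 1 - α - 1 = -α by ring]
  ring

/-- Splitting `e^{-η(t-s)}` into `e^{-ηt} e^{ηs}` is the change of unknown `v = e^{ηt} u` that
removes the tempering. -/
theorem temperedKer_smul {α η t s : ℝ} (hs : s ∈ Ioo 0 t) (x : E) :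
    temperedKer α η (t - s) • x =
      Real.exp (-η * t) • (gKer (1 - α) (t - s) • (Real.exp (η * s) • x)) := by
  rw [temperedKer_eq (sub_pos.2 hs.2), show -η * (t - s) = -η * t + η * s by ring, Real.exp_add,
    smul_smul, smul_smul]
  congr 1
  ring

theorem conv_temperedKer {α η t : ℝ} (ht : 0 ≤ t) (u : ℝ → E) :
    conv (temperedKer α η) u t =
      Real.exp (-η * t) • conv (gKer (1 - α)) (fun s => Real.exp (η * s) • u s) t := by
  rw [conv, conv, ← intervalIntegral.integral_smul]
  simp only [intervalIntegral.integral_of_le ht, integral_Ioc_eq_integral_Ioo]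
  exact setIntegral_congr_fun measurableSet_Ioo fun s hs => temperedKer_smul hs _

theorem integrableOn_gKer {α : ℝ} (hα1 : α < 1) (t : ℝ) :
    IntegrableOn (gKer (1 - α)) (Ioc 0 t) :=
  (hasPowBound_gKer (by linarith)).integrableOn (by linarith) t

theorem integrableOn_temperedKer {α η : ℝ} (hα1 : α < 1) (t : ℝ) :
    IntegrableOn (temperedKer α η) (Ioc 0 t) := by
  have h : IntegrableOn (fun s => Real.exp (-η * s) * gKer (1 - α) s) (Icc 0 t) := by
    refine IntegrableOn.continuousOn_mul (by fun_prop) ?_ isCompact_Icc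
    rw [integrableOn_Icc_iff_integrableOn_Ioc]
    exact integrableOn_gKer hα1 t
  exact (h.mono_set Ioc_subset_Icc_self).congr_fun (fun s hs => (temperedKer_eq hs.1).symm)
    measurableSet_Ioc

theorem conv_zero (k : ℝ → ℝ) (u : ℝ → E) : conv k u 0 = 0 := by simp [conv]

theorem conv_const [CompleteSpace E] (k : ℝ → ℝ) (x : E) (t : ℝ) :
    conv k (fun _ => x) t = (∫ s in (0 : ℝ)..t, k s) • x := by
  rw [conv, intervalIntegral.integral_smul_const, intervalIntegral.integral_comp_sub_left, sub_self,
    sub_zero]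

theorem conv_sub {k : ℝ → ℝ} {u v : ℝ → E} {t : ℝ} (ht : 0 ≤ t) (hk : IntegrableOn k (Ioc 0 t))
    (hu : ContinuousOn u (Ici 0)) (hv : ContinuousOn v (Ici 0)) :
    conv k (fun s => u s - v s) t = conv k u t - conv k v t := by
  simp only [conv, smul_sub]
  exact intervalIntegral.integral_sub (intervalIntegrable_conv ht hk hu)
    (intervalIntegrable_conv ht hk hv)

theorem conv_congr {k : ℝ → ℝ} {u v : ℝ → E} {t : ℝ} (ht : 0 ≤ t)
    (h : ∀ s ∈ Ioo 0 t, u s = v s) : conv k u t = conv k v t :=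
  bconv_congr (lsmul ℝ ℝ) ht (fun _ _ => rfl) h

end Auxiliary

/-! ### Solutions of (P): reduction to the untempered equation, uniqueness, existence,
well-posedness. -/

section Solutions

open ContinuousLinearMap (lsmul)

variable {H : Type*} [NormedAddCommGroup H] [InnerProductSpace ℂ H]

theorem bconv_flip_lsmul_invLaplace {A : H →ₗ.[ℂ] H} {α t : ℝ} (ht : 0 < t) :
    bconv (lsmul ℝ ℝ).flip (invLaplace A α) (gKer (1 - α)) t = solOp A α t := by
  rw [bconv_flip, bconv_lsmul, solOp_of_pos ht]

theorem opVal_smul (A : H →ₗ.[ℂ] H) (r : ℝ) {x : H} (hx : x ∈ A.domain) :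
    opVal A (r • x) = r • opVal A x := by
  have h : (r : ℂ) • x ∈ A.domain := A.domain.smul_mem _ hx
  rw [← Complex.coe_smul, ← Complex.coe_smul r (opVal A x), opVal_of_mem h, opVal_of_mem hx,
    ← A.map_smul]
  rfl

theorem StrongRegularity.continuousOn_exp_smul {A : H →ₗ.[ℂ] H} {α η : ℝ} {u0 : H} {u : ℝ → H}
    (h : StrongRegularity A α η u0 u) : ContinuousOn (fun t => Real.exp (η * t) • u t) (Ici 0) :=
  continuousOn_smul_exp h.continuousOn η

variable [CompleteSpace H]

theorem StrongRegularity.continuousOn_conv {A : H →ₗ.[ℂ] H} {α η : ℝ} (hα1 : α < 1) {u0 : H}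
    {u : ℝ → H} (h : StrongRegularity A α η u0 u) :
    ContinuousOn (conv (gKer (1 - α)) fun s => Real.exp (η * s) • u s) (Ici 0) := by
  have hc := (IntegrableOn.continuousOn_integral (integrableOn_gKer hα1)).smul
    (continuousOn_const (c := u0))
  refine (h.contDiffOn.continuousOn.add hc).congr fun t ht => ?_
  rw [Pi.add_apply, conv_sub ht (integrableOn_gKer hα1 t) h.continuousOn_exp_smul
    continuousOn_const, conv_const]
  simp

theorem StrongRegularity.continuousOn_conv_temperedKer {A : H →ₗ.[ℂ] H} {α η : ℝ} (hα1 : α < 1)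
    {u0 : H} {u : ℝ → H} (h : StrongRegularity A α η u0 u) :
    ContinuousOn (conv (temperedKer α η) u) (Ici 0) := by
  exact (continuousOn_smul_exp (h.continuousOn_conv hα1) (-η)).congr fun t ht =>
    conv_temperedKer ht u

variable {A : H →ₗ.[ℂ] H} {α η : ℝ}

/-- Writing `k` for the tempered kernel, `u - u(0) = 1 * w` gives `k * (u - u(0)) = 1 * (k * w)`. By
the equation `k * w` agrees for `t > 0` with a continuous function, so the fundamental theorem of
calculus applies. -/
theorem IsStrongSolution.isExtendedStrongSolution (hα1 : α < 1) {u0 : H} {u : ℝ → H}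
    (h : IsStrongSolution A α η u0 u) : IsExtendedStrongSolution A α η u0 u := by
  obtain ⟨hreg, h0, w, ⟨hwi, hw⟩, heq⟩ := h
  refine ⟨hreg, h0, fun t ht => ?_⟩
  have hwi' : ∀ T, 0 < T → IntegrableOn w (Ioc 0 T) := fun T hT =>
    (intervalIntegrable_iff_integrableOn_Ioc_of_le hT.le).1 (hwi T hT)
  have hc : ContinuousOn (fun t => opVal A (u t) - η • conv (temperedKer α η) u t) (Ici 0) :=
    hreg.continuousOn_op.sub ((hreg.continuousOn_conv_temperedKer hα1).const_smul η)
  have hd := hasDerivAt_integral_of_continuousOn_Ioi (hc.mono Ioi_subset_Ici_self) ht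
    (integrableOn_of_continuousOn_Ici hc t)
  refine hd.congr_of_eventuallyEq ?_
  filter_upwards [lt_mem_nhds ht] with s hs
  rw [conv_congr hs.le (v := fun s => ∫ r in (0 : ℝ)..s, w r) fun r hr => by
    rw [hw r hr.1.le, add_sub_cancel_left], conv_integral hs (integrableOn_temperedKer hα1 s)
    (hwi' s hs)]
  refine intervalIntegral.integral_congr_ae (Eventually.of_forall fun r hr => ?_)
  rw [uIoc_of_le hs.le] at hr
  exact (heq r hr.1).2

/-- The extended derivative sees `D = g * (v - e)` with `e(s) = e^{ηs} u⁰`, not `g * (v - u⁰)`. The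
product rule gives `D' = e^{ηt} Au - g * (ηe)`, and the correction is exact since `e - u⁰ = 1 *
(ηe)`. -/
theorem IsExtendedStrongSolution.conv_eq_integral (hα1 : α < 1) {u0 : H} {u : ℝ → H}
    (h : IsExtendedStrongSolution A α η u0 u) {t : ℝ} (ht : 0 < t) :
    conv (gKer (1 - α)) (fun s => Real.exp (η * s) • u s - u0) t =
      ∫ s in (0 : ℝ)..t, Real.exp (η * s) • opVal A (u s) := by
  obtain ⟨hreg, h0, hd⟩ := h
  set g := gKer (1 - α)
  have hg : ∀ t, IntegrableOn g (Ioc 0 t) := integrableOn_gKer hα1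
  set e : ℝ → H := fun s => Real.exp (η * s) • u0
  have he : ContinuousOn e (Ici 0) := Continuous.continuousOn (by fun_prop)
  have hV := hreg.continuousOn_exp_smul
  have hAV : ContinuousOn (fun s => Real.exp (η * s) • opVal A (u s)) (Ici 0) :=
    continuousOn_smul_exp hreg.continuousOn_op η
  have hηe : ContinuousOn (fun s => η • e s) (Ici 0) := he.const_smul η
  have hgei : ∀ t, IntegrableOn (conv g fun s => η • e s) (Ioc 0 t) := fun t =>
    integrableOn_bconv (lsmul ℝ ℝ) (hg t) (integrableOn_of_continuousOn_Ici hηe t)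
  have hee : ∀ t : ℝ, e t - u0 = ∫ s in (0 : ℝ)..t, η • e s := by
    intro t
    rw [intervalIntegral.integral_eq_sub_of_hasDerivAt (f := e)]
    · simp [e]
    · intro s _
      simpa only [e, smul_smul] using (hasDerivAt_exp_mul η s).smul_const u0
    · exact Continuous.intervalIntegrable (by fun_prop) _ _
  have hge : ∀ t : ℝ, 0 ≤ t → conv g (fun s => e s - u0) t =
      ∫ s in (0 : ℝ)..t, conv g (fun s => η • e s) s := by
    intro t ht
    rcases ht.eq_or_lt with rfl | ht
    · simp [conv_zero]
    · simp only [hee]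
      exact conv_integral ht (hg t) (integrableOn_of_continuousOn_Ici hηe t)
  set D : ℝ → H := fun t => conv g (fun s => Real.exp (η * s) • u s - e s) t with hD
  have hDeq : ∀ t : ℝ, 0 ≤ t → D t = conv g (fun s => Real.exp (η * s) • u s - u0) t -
      ∫ s in (0 : ℝ)..t, conv g (fun s => η • e s) s := by
    intro t ht
    have hV' : ContinuousOn (fun s => Real.exp (η * s) • u s - u0) (Ici 0) :=
      hV.sub continuousOn_const
    have he' : ContinuousOn (fun s => e s - u0) (Ici 0) := he.sub continuousOn_const
    rw [← hge t ht, ← conv_sub ht (hg t) hV' he']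
    simp only [hD, sub_sub_sub_cancel_right]
  -- The derivative of `D` is known only for `t > 0`; continuity at `0`, taken from the required
  -- regularity, allows integration from `0`.
  have hDc : ContinuousOn D (Ici 0) :=
    (hreg.contDiffOn.continuousOn.sub (IntegrableOn.continuousOn_integral hgei)).congr
      fun t ht => hDeq t ht
  have hDk : ∀ t : ℝ, 0 < t →
      D t = Real.exp (η * t) • conv (temperedKer α η) (fun s => u s - u 0) t := by
    intro t ht
    rw [conv_temperedKer ht.le, smul_smul, ← Real.exp_add]
    simp only [h0, smul_sub, hD, e]
    rw [show η * t + -η * t = 0 by ring, Real.exp_zero, one_smul]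
  have hDsub : ∀ t : ℝ, 0 ≤ t → D t = conv g (fun s => Real.exp (η * s) • u s) t - conv g e t :=
    fun t ht => conv_sub ht (hg t) hV he
  have hcη : ∀ t : ℝ, conv g (fun s => η • e s) t = η • conv g e t := fun t => by
    simp only [conv, smul_comm _ η]
    exact intervalIntegral.integral_smul _ _
  have hDd : ∀ t : ℝ, 0 < t → HasDerivAt D
      (Real.exp (η * t) • opVal A (u t) - conv g (fun s => η • e s) t) t := by
    intro t ht
    have h2 := ((hasDerivAt_exp_mul η t).smul (hd t ht)).congr_of_eventuallyEq (f₁ := D)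
      ((lt_mem_nhds ht).mono fun s hs => hDk s hs)
    refine h2.congr_deriv ?_
    have h3 : Real.exp (η * t) • conv (temperedKer α η) u t =
        conv g (fun s => Real.exp (η * s) • u s) t := by
      rw [conv_temperedKer ht.le, smul_smul, ← Real.exp_add, show η * t + -η * t = 0 by ring,
        Real.exp_zero, one_smul]
    rw [mul_smul, ← hDk t ht, hDsub t ht.le, smul_sub (Real.exp _), smul_comm (Real.exp _) η, h3,
      hcη, smul_sub]
    abel
  have hi1 := intervalIntegrable_of_continuousOn_Ici hAV ht.le
  have hi2 : IntervalIntegrable (conv g fun s => η • e s) volume 0 t :=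
    (intervalIntegrable_iff_integrableOn_Ioc_of_le ht.le).2 (hgei t)
  have hftc := intervalIntegral.integral_eq_sub_of_hasDerivAt_of_le ht.le
    (hDc.mono Icc_subset_Ici_self) (fun s hs => hDd s hs.1) (hi1.sub hi2)
  have hD0 : D 0 = 0 := conv_zero _ _
  rw [intervalIntegral.integral_sub hi1 hi2, hD0, sub_zero, hDeq t ht.le] at hftc
  exact (sub_left_injective hftc).symm

/-- Evaluation of bounded operators as a bounded real-bilinear map. -/
noncomputable def evalBilin (H : Type*) [NormedAddCommGroup H] [InnerProductSpace ℂ H] :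
    (H →L[ℂ] H) →L[ℝ] H →L[ℝ] H :=
  ContinuousLinearMap.restrictScalarsL ℂ H H ℝ ℝ

theorem evalBilin_apply {H : Type*} [NormedAddCommGroup H] [InnerProductSpace ℂ H]
    (T : H →L[ℂ] H) (x : H) : evalBilin H T x = T x := rfl

variable (hA : IsMDissipative A) (hα0 : 0 < α) (hα1 : α < 1)
include hA hα0 hα1

/-- A function with `g_{1-α} * (v - x) = 1 * A v` is given by the solution operator. -/
theorem eq_solOp_of_conv_eq {x : H} {v y : ℝ → H} (hv : ContinuousOn v (Ici 0))
    (hvd : ∀ t, 0 ≤ t → v t ∈ A.domain) (hy : ∀ t, 0 ≤ t → opVal A (v t) = y t)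
    (hyc : ContinuousOn y (Ici 0)) (hvx : v 0 = x)
    (h : ∀ t, 0 < t → conv (gKer (1 - α)) (fun s => v s - x) t = ∫ s in (0 : ℝ)..t, y s)
    {t : ℝ} (ht : 0 ≤ t) : v t = solOp A α t x := by
  rcases ht.eq_or_lt with rfl | ht
  · rw [solOp_zero, hvx]; rfl
  have hP := hasPowBound_invLaplace hA hα0 hα1
  set P := invLaplace A α
  set Q : ℝ → H →L[ℂ] H := fun t => ∫ s in (0 : ℝ)..t, P s
  have hQc : ContinuousOn Q (Ici 0) := IntegrableOn.continuousOn_integral (hP.integrableOn hα0)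
  have hSc : ContinuousOn (fun t => solOp A α t x) (Ici 0) :=
    continuousOn_solOp_apply hA hα0 hα1 x
  have hSQ : ∀ s : ℝ, 0 ≤ s → ∀ z ∈ A.domain, solOp A α s z = z + Q s (opVal A z) := by
    intro s hs z hz
    rw [solOp_apply_eq hA hα0 hα1 hz hs]
    congr 1
    simp only [Q, intervalIntegral.integral_of_le hs]
    exact (ContinuousLinearMap.integral_apply (hP.integrableOn hα0 s) _).symm
  -- Convolve the hypothesis with `P` and regroup: `P * g_{1-α} = S` and `P * 1 = Q`.
  have hconv : ∀ t : ℝ, 0 < t → bconv (evalBilin H) (solOp A α) (fun s => v s - x) t =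
      bconv (evalBilin H) Q y t := by
    intro t ht
    have hL : ∀ (T : H →L[ℂ] H) (r : ℝ) (z : H),
        evalBilin H ((lsmul ℝ ℝ).flip T r) z = evalBilin H T (lsmul ℝ ℝ r z) := by
      intro T r z
      simp [evalBilin_apply]
    have h1 : IntegrableOn (fun _ : ℝ => (1 : ℝ)) (Ioc 0 t) := by simp
    have hvx : ContinuousOn (fun s => v s - x) (Ici 0) := hv.sub continuousOn_const
    have a := bconv_assoc _ _ _ _ hL ht (hP.integrableOn hα0 t) (integrableOn_gKer hα1 t)
      (integrableOn_of_continuousOn_Ici hvx t)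
      (Or.inr (exists_integral_norm_mul_le (integrableOn_gKer hα1 t) hvx))
    have b := bconv_assoc _ _ _ _ hL ht (hP.integrableOn hα0 t) h1
      (integrableOn_of_continuousOn_Ici hyc t) (Or.inr (exists_integral_norm_mul_le h1 hyc))
    have c : bconv (evalBilin H) P (bconv (lsmul ℝ ℝ) (gKer (1 - α)) fun s => v s - x) t =
        bconv (evalBilin H) P (bconv (lsmul ℝ ℝ) (fun _ => 1) y) t := by
      refine bconv_congr _ ht.le (fun _ _ => rfl) fun s hs => ?_
      rw [bconv_lsmul, bconv_lsmul, h s hs.1, conv_one]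
    rw [c, ← b] at a
    refine Eq.trans ?_ (a.trans ?_)
    · exact bconv_congr _ ht.le (fun s hs => (bconv_flip_lsmul_invLaplace hs.1).symm)
        fun _ _ => rfl
    · refine bconv_congr _ ht.le (fun s hs => ?_) fun _ _ => rfl
      rw [bconv_flip, bconv_lsmul, conv_one]
  rw [← sub_eq_zero]
  refine eq_zero_of_integral_eq_zero (p := fun t => v t - solOp A α t x) (hv.sub hSc) ?_ ht
  intro t ht
  have hmaps : MapsTo (fun s => t - s) (Icc 0 t) (Ici 0) := fun s hs => sub_nonneg.2 hs.2
  have hcQ : ContinuousOn (fun s => Q (t - s) (y s)) (Icc 0 t) :=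
    (hQc.comp (by fun_prop) hmaps).clm_apply (hyc.mono Icc_subset_Ici_self)
  have hcS : ContinuousOn (fun s => solOp A α (t - s) x) (Icc 0 t) := hSc.comp (by fun_prop) hmaps
  have hcv : ContinuousOn v (Icc 0 t) := hv.mono Icc_subset_Ici_self
  have hint : ∀ {f : ℝ → H}, ContinuousOn f (Icc 0 t) → IntervalIntegrable f volume 0 t :=
    fun hf => by
      rw [← uIcc_of_le ht.le] at hf
      exact hf.intervalIntegrable
  have key := hconv t ht
  -- Since `v s` is in the domain, `S(t-s) v(s) = v(s) + Q(t-s) y(s)`. The `Q`-terms cancel, leaving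
  -- equal primitives of `v` and `Sx`.
  have e1 : bconv (evalBilin H) (solOp A α) (fun s => v s - x) t =
      ∫ s in (0 : ℝ)..t, (v s - solOp A α (t - s) x) + Q (t - s) (y s) := by
    refine intervalIntegral.integral_congr fun s hs => ?_
    rw [uIcc_of_le ht.le] at hs
    simp only [evalBilin_apply, map_sub]
    rw [hSQ _ (sub_nonneg.2 hs.2) _ (hvd s hs.1), hy s hs.1]
    abel
  rw [e1, intervalIntegral.integral_add ((hint hcv).sub (hint hcS)) (hint hcQ)] at key
  have key2 : ∫ s in (0 : ℝ)..t, (v s - solOp A α (t - s) x) = 0 := by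
    simpa [bconv, evalBilin_apply] using key
  rw [intervalIntegral.integral_sub (hint hcv) (hint hcS),
    intervalIntegral.integral_comp_sub_left (fun s => solOp A α s x), sub_self, sub_zero] at key2
  rw [intervalIntegral.integral_sub (hint hcv) (hint (hSc.mono Icc_subset_Ici_self)), key2]

theorem IsExtendedStrongSolution.eq_solOp {u0 : H} {u : ℝ → H}
    (h : IsExtendedStrongSolution A α η u0 u) {t : ℝ} (ht : 0 ≤ t) :
    u t = Real.exp (-η * t) • solOp A α t u0 := by
  have hreg := h.1
  have hAV : ContinuousOn (fun s => Real.exp (η * s) • opVal A (u s)) (Ici 0) :=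
    continuousOn_smul_exp hreg.continuousOn_op η
  have := eq_solOp_of_conv_eq hA hα0 hα1 (x := u0) hreg.continuousOn_exp_smul
    (fun t ht => by
      rw [← Complex.coe_smul]; exact A.domain.smul_mem _ (hreg.mem_domain t ht))
    (fun t ht => opVal_smul A _ (hreg.mem_domain t ht)) hAV (by simp [h.2.1])
    (fun t ht => h.conv_eq_integral hα1 ht) ht
  rw [← this, smul_smul, ← Real.exp_add, show -η * t + η * t = 0 by ring, Real.exp_zero, one_smul]

theorem hasDerivAt_solOp_apply {x : H} (hx : x ∈ A.domain) {t : ℝ} (ht : 0 < t) :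
    HasDerivAt (fun s => solOp A α s x) (invLaplace A α t (opVal A x)) t := by
  have hp := hasPowBound_invLaplace_apply hA hα0 hα1 (opVal A x)
  refine ((hasDerivAt_integral_of_continuousOn_Ioi hp.continuousOn ht
    (hp.integrableOn hα0 t)).const_add x).congr_of_eventuallyEq ?_
  filter_upwards [lt_mem_nhds ht] with s hs using solOp_apply_eq hA hα0 hα1 hx hs.le

/-- With `y = A u⁰`, the derivative is `w = e^{-ηt} (-η S u⁰ + P y)`, integrable because `P =
O(t^{α-1})`. Convolving with the tempered kernel `k`, the first term gives `-η k * u` and the second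
`e^{-ηt} S y = A u`. Regularity comes from `g_{1-α} * (S u⁰ - u⁰) = 1 * S y`. -/
theorem isStrongSolution_solOp {u0 : H} (hu0 : u0 ∈ A.domain) :
    IsStrongSolution A α η u0 (fun t => Real.exp (-η * t) • solOp A α t u0) := by
  set y := opVal A u0
  have hp := hasPowBound_invLaplace_apply hA hα0 hα1 y
  have hSc := continuousOn_solOp_apply hA hα0 hα1 u0
  have hSyc := continuousOn_solOp_apply hA hα0 hα1 y
  have hop : ∀ t : ℝ, opVal A (Real.exp (-η * t) • solOp A α t u0) =
      Real.exp (-η * t) • solOp A α t y := fun t => by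
    rw [opVal_smul A _ (solOp_mem_domain hA hα0 hα1 t hu0), opVal_solOp hA hα0 hα1 t hu0]
  have hcancel : ∀ (t : ℝ) (z : H), Real.exp (η * t) • (Real.exp (-η * t) • z) = z := fun t z => by
    rw [smul_smul, ← Real.exp_add, show η * t + -η * t = 0 by ring, Real.exp_zero, one_smul]
  have huc : ContinuousOn (fun t => Real.exp (-η * t) • solOp A α t u0) (Ici 0) :=
    continuousOn_smul_exp hSc (-η)
  have hwi : ∀ T, 0 < T → IntervalIntegrable (fun t => Real.exp (-η * t) • invLaplace A α t y)
      volume 0 T := fun T hT =>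
    ((intervalIntegrable_iff_integrableOn_Ioc_of_le hT.le).2
      (hp.integrableOn hα0 T)).continuousOn_smul
        (Continuous.continuousOn (by fun_prop))
  refine ⟨⟨huc, fun t _ => ?_, ?_, ?_⟩, ?_, fun t => -η • (Real.exp (-η * t) • solOp A α t u0) +
    Real.exp (-η * t) • invLaplace A α t y, ⟨fun T hT => ?_, fun t ht => ?_⟩, fun t ht => ?_⟩
  · rw [← Complex.coe_smul]
    exact A.domain.smul_mem _ (solOp_mem_domain hA hα0 hα1 t hu0)
  · simp only [hop]
    exact continuousOn_smul_exp hSyc (-η)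
  · refine (contDiffOn_integral hSyc).congr fun t ht => ?_
    simp only [hcancel]
    rcases (mem_Ici.1 ht).eq_or_lt with rfl | ht
    · simp [conv_zero]
    rw [conv_congr ht.le (v := fun s => ∫ r in (0 : ℝ)..s, invLaplace A α r y) fun s hs => by
      rw [solOp_apply_eq hA hα0 hα1 hu0 hs.1.le, add_sub_cancel_left],
      conv_integral ht (integrableOn_gKer hα1 t) (hp.integrableOn hα0 t)]
    refine intervalIntegral.integral_congr_ae (Eventually.of_forall fun s hs => ?_)
    rw [uIoc_of_le ht.le] at hs
    exact (solOp_apply hA hα0 hα1 hs.1 y).symm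
  · simp [solOp_zero]
  · exact (intervalIntegrable_of_continuousOn_Ici (huc.const_smul (-η)) hT.le).add (hwi T hT)
  · rcases ht.eq_or_lt with rfl | ht
    · simp
    have hd : ∀ s ∈ Ioo 0 t, HasDerivAt (fun t => Real.exp (-η * t) • solOp A α t u0)
        (-η • (Real.exp (-η * s) • solOp A α s u0) + Real.exp (-η * s) • invLaplace A α s y) s := by
      intro s hs
      refine ((hasDerivAt_exp_mul (-η) s).smul (hasDerivAt_solOp_apply hA hα0 hα1 hu0 hs.1)).congr_deriv ?_
      rw [mul_smul, add_comm]
    rw [intervalIntegral.integral_eq_sub_of_hasDerivAt_of_le ht.le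
      (huc.mono Icc_subset_Ici_self) hd
      ((intervalIntegrable_of_continuousOn_Ici (huc.const_smul (-η)) ht.le).add (hwi t ht)),
      add_sub_cancel]
  · have hw : ∀ s : ℝ, Real.exp (η * s) • (-η • (Real.exp (-η * s) • solOp A α s u0) +
        Real.exp (-η * s) • invLaplace A α s y) = -η • solOp A α s u0 + invLaplace A α s y := by
      intro s
      rw [smul_add, hcancel, smul_comm, hcancel]
    have hi1 := intervalIntegrable_conv ht.le (integrableOn_gKer hα1 t) hSc
    have hi2 := hp.intervalIntegrable_gKer_smul hα0 hα1 ht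
    have hi1' : IntervalIntegrable (fun s => -η • gKer (1 - α) (t - s) • solOp A α s u0)
        volume 0 t := hi1.smul (-η)
    constructor
    · have hi := (hi1'.add hi2).smul (Real.exp (-η * t))
      refine hi.congr_ae ?_
      rw [uIoc_of_le ht.le, Filter.EventuallyEq, ← restrict_Ioo_eq_restrict_Ioc,
        ae_restrict_iff' measurableSet_Ioo]
      refine Eventually.of_forall fun s hs => ?_
      rw [temperedKer_smul hs, hw]
      simp only [Pi.smul_apply]
      rw [smul_add (gKer _ _), smul_comm (gKer _ _)]
    · rw [conv_temperedKer ht.le, conv_temperedKer ht.le, hop]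
      simp only [hw, hcancel]
      rw [smul_comm η, ← smul_sub]
      congr 1
      rw [solOp_apply hA hα0 hα1 ht, conv, conv, conv]
      simp only [smul_add, smul_comm _ (-η)]
      rw [intervalIntegral.integral_add hi1' hi2, intervalIntegral.integral_smul,
        neg_smul, neg_add_eq_sub]

/-- Every solution equals `e^{-ηt} S(t) u⁰`, so uniqueness is immediate and the bound on `S` gives
continuous dependence. -/
theorem wellPosed_isExtendedStrongSolution : WellPosed A (IsExtendedStrongSolution A α η) where
  exists_solution u0 hu0 :=
    ⟨_, (isStrongSolution_solOp hA hα0 hα1 hu0).isExtendedStrongSolution hα1⟩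
  unique_solution u0 _ u v hu hv t ht := by
    rw [hu.eq_solOp hA hα0 hα1 ht, hv.eq_solOp hA hα0 hα1 ht]
  continuous_dependence u0 u _ hu hlim T _ := by
    obtain ⟨M, hM0, hM⟩ := exists_norm_solOp_le hA hα0 hα1
    -- An upper bound for `e^{-ηt}` on `[0, T]`.
    set K := Real.exp (|η| * T)
    have hK : 0 < K := Real.exp_pos _
    rw [Metric.tendstoUniformlyOn_iff]
    intro ε hε
    have hev : ∀ᶠ n in atTop, ‖u0 n‖ < ε / (K * M) :=
      (tendsto_zero_iff_norm_tendsto_zero.1 hlim).eventually_lt_const (by positivity)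
    filter_upwards [hev] with n hn t ht
    rw [dist_zero_left, (hu n).eq_solOp hA hα0 hα1 ht.1, norm_smul,
      Real.norm_of_nonneg (Real.exp_pos _).le]
    rw [lt_div_iff₀ (by positivity)] at hn
    have h1 : Real.exp (-η * t) ≤ K := Real.exp_le_exp.2
      ((mul_le_mul_of_nonneg_right (neg_le_abs η) ht.1).trans
        (mul_le_mul_of_nonneg_left ht.2 (abs_nonneg η)))
    calc Real.exp (-η * t) * ‖solOp A α t (u0 n)‖ ≤ K * (M * ‖u0 n‖) := by
          gcongr
          exact (solOp A α t).le_of_opNorm_le (hM t) _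
      _ = ‖u0 n‖ * (K * M) := by ring
      _ < ε := hn

theorem wellPosed_isStrongSolution : WellPosed A (IsStrongSolution A α η) where
  exists_solution u0 hu0 := ⟨_, isStrongSolution_solOp hA hα0 hα1 hu0⟩
  unique_solution u0 hu0 u v hu hv :=
    (wellPosed_isExtendedStrongSolution hA hα0 hα1).unique_solution u0 hu0 u v
      (hu.isExtendedStrongSolution hα1) (hv.isExtendedStrongSolution hα1)
  continuous_dependence u0 u hu0 hu :=
    (wellPosed_isExtendedStrongSolution hA hα0 hα1).continuous_dependence u0 u hu0
      fun n => (hu n).isExtendedStrongSolution hα1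

theorem isSolutionOperator_solOp :
    IsSolutionOperator A α η fun t => Real.exp (-η * t) • solOp A α t where
  strongly_continuous x := continuousOn_smul_exp (continuousOn_solOp_apply hA hα0 hα1 x) (-η)
  map_zero := by
    rw [mul_zero, Real.exp_zero, one_smul, solOp_zero]; rfl
  map_domain t _ x hx := by
    rw [← Complex.coe_smul]
    exact A.domain.smul_mem _ (solOp_mem_domain hA hα0 hα1 t hx)
  commutes t _ x hx := by
    rw [smul_apply, opVal_smul A _ (solOp_mem_domain hA hα0 hα1 t hx),
      opVal_solOp hA hα0 hα1 t hx, smul_apply]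
  resolvent_eq x hx t ht := by
    have h : ∀ s : ℝ, Real.exp (η * s) • opVal A ((Real.exp (-η * s) • solOp A α s) x) =
        solOp A α s (opVal A x) := fun s => by
      rw [smul_apply, opVal_smul A _ (solOp_mem_domain hA hα0 hα1 s hx),
        opVal_solOp hA hα0 hα1 s hx, smul_smul, ← Real.exp_add,
        show η * s + -η * s = 0 by ring, Real.exp_zero, one_smul]
    simp only [h]
    rw [smul_apply, solOp_resolvent_eq hA hα0 hα1 hx ht, smul_add]

end Solutions

end FracCauchy

theorem theorem2p1 {H : Type*} [NormedAddCommGroup H] [InnerProductSpace ℂ H] [CompleteSpace H]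
    (A : H →ₗ.[ℂ] H) (hA : FracCauchy.IsMDissipative A)
    (α η : ℝ) (hα0 : 0 < α) (hα1 : α < 1) (hη : 0 ≤ η) :
    FracCauchy.WellPosed A (FracCauchy.IsStrongSolution A α η) ∧
    FracCauchy.WellPosed A (FracCauchy.IsExtendedStrongSolution A α η) ∧
    ∃ S : ℝ → H →L[ℂ] H,
      FracCauchy.IsSolutionOperator A α η S ∧
      (∀ u0 ∈ A.domain, FracCauchy.IsStrongSolution A α η u0 (fun t => S t u0)) ∧
      (0 < η → ∃ M : ℝ, 0 < M ∧ ∀ u0 ∈ A.domain, ∀ t : ℝ, 0 ≤ t →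
        ‖S t u0‖ ≤ M * Real.exp (-η * t) * ‖u0‖) := by
  refine ⟨FracCauchy.wellPosed_isStrongSolution hA hα0 hα1,
    FracCauchy.wellPosed_isExtendedStrongSolution hA hα0 hα1,
    fun t => Real.exp (-η * t) • FracCauchy.solOp A α t,
    FracCauchy.isSolutionOperator_solOp hA hα0 hα1,
    fun u0 hu0 => FracCauchy.isStrongSolution_solOp hA hα0 hα1 hu0, fun _ => ?_⟩
  -- The untempered operator is only bounded; the decay is that of the factor `e^{-ηt}`.
  obtain ⟨M, hM0, hM⟩ := FracCauchy.exists_norm_solOp_le hA hα0 hα1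
  refine ⟨M, hM0, fun u0 _ t _ => ?_⟩
  rw [smul_apply, norm_smul, Real.norm_of_nonneg (Real.exp_pos _).le]
  calc Real.exp (-η * t) * ‖FracCauchy.solOp A α t u0‖
      ≤ Real.exp (-η * t) * (M * ‖u0‖) := by
        gcongr
        exact (FracCauchy.solOp A α t).le_of_opNorm_le (hM t) _
    _ = M * Real.exp (-η * t) * ‖u0‖ := by ring
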